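/- **Setting.** Let $k$ be a field, $\Omega$ a nonempty set and $X$, $Z$ sets. For a set $Y$, let $\mathcal M(Y)$ be the free monoid on $Y$, and let $\mathfrak M(Y)\supseteq\mathcal M(Y)$ be the free $\Omega$-monoid on $Y$: its elements (words) are finite sequences of letters, each letter being an element of $Y$ or a bracket $\lfloor u\rfloor_\omega$ with $\omega\in\Omega$, $u\in\mathfrak M(Y)$; the number of letters of $w$ at the outermost level is its breadth $|w|$. Then $k\mathfrak M(Y)$ is the free unital $\Omega$-algebra, with the linear operators $P_\omega(u)=\lfloor u\rfloor_\omega$; an $\Omega$-ideal is a two-sided ideal closed under all $P_\omega$, and $\langle S\rangle_\Omega$ is the $\Omega$-ideal generated by $S$. Let $\mathfrak M^\star(Y)$ be the set of words over $Y\sqcup\{\star\}$ in which $\star$ occurs exactly once; for $q\in\mathfrak M^\star(Y)$ and a word $u$, $q|_u$ is obtained by replacing $\star$ by $u$ (extended linearly in $u$), and $u$ is called a subword of $q|_u$. A monomial order on $\mathfrak M(Z)$ is a well-order such that $u<v$ implies $q|_u<q|_v$ for all $q\in\mathfrak M^\star(Z)$. For a linear order on words, the leading monomial $\bar f$ of $f\neq0$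 is the largest word occurring in $f$, and $\bar 0=1$. **Gröbner–Shirshov bases.** Let $\le$ be a monomial order on $\mathfrak M(Z)$ and $\mathcal G\subseteq k\mathfrak M(Z)$. An element $h$ is trivial modulo $(\mathcal G,p)$ if it is a finite sum $\sum_i c_iq_i|_{s_i}$ with $c_i\in k$, $q_i\in\mathfrak M^\star(Z)$, $s_i\in\mathcal G$ and $q_i|_{\bar s_i}<p$. The set $\mathcal G$ is an $\Omega$-GS basis in $k\mathfrak M(Z)$ if for all nonzero elements of $\mathcal G$, divided by their leading coefficients and then called $f,g$: (i) whenever $p=\bar fu=v\bar g$ with $\max\{|\bar f|,|\bar g|\}<|p|<|\bar f|+|\bar g|$, the element $fu-vg$ is trivial modulo $(\mathcal G,p)$; (ii) whenever $p=\bar f=q|_{\bar g}$ with $q\in\mathfrak M^\star(Z)$, the element $f-q|_g$ is trivial modulo $(\mathcal G,p)$. It is an $\Omega$-GS basis of an $\Omega$-ideal $I$ if moreover $\langle\mathcal G\rangle_\Omega=I$. A GS basis of a two-sided ideal of $k\mathcal M(Z)$ is defined in the same way, with $\mathcal M(Z)$ in place of $\mathfrak M(Z)$, word length in place of breadth, and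 $q=a\star b$ with $a,b\in\mathcal M(Z)$. **OPIs.** An OPI is an element $\phi=\phi(x_1,\dots,x_n)\in k\mathfrak M(X)$, with $n\ge1$ and distinct $x_1,\dots,x_n\in X$, that is multilinear: each word occurring in $\phi$ contains each $x_i$ exactly once and no other element of $X$. For $u_1,\dots,u_n\in\mathfrak M(Z)$, $\phi(u_1,\dots,u_n)\in k\mathfrak M(Z)$ is obtained by replacing each $x_i$ by $u_i$. For a set $\Phi$ of OPIs put $S_\Phi(\mathfrak M(Z))=\{\phi(u_1,\dots,u_n): \phi\in\Phi,\ u_1,\dots,u_n\in\mathfrak M(Z)\}$. Leading monomials $\bar\phi\in\mathfrak M(X)$ of OPIs are taken with respect to a fixed linear order on $\mathfrak M(X)$, and $\bar\phi(u_1,\dots,u_n)$ is obtained from $\bar\phi$ by the same replacement. **Theorem.** Let $\Phi\subseteq k\mathfrak M(X)$ be a set of OPIs, let $\le$ be a monomial order on $\mathfrak M(Z)$, and let $A=k\mathcal M(Z)/I_A$ be a unital algebra, where $I_A$ is a two-sided ideal of $k\mathcal M(Z)$. Assume: 1. $\Phi$ is $\Omega$-GS on $k\mathfrak M(Z)$ with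 respect to $\le$, that is, $S_\Phi(\mathfrak M(Z))$ is an $\Omega$-GS basis in $k\mathfrak M(Z)$; 2. $G\subseteq k\mathcal M(Z)$ is a GS basis of $I_A$ with respect to the restriction of $\le$ to $\mathcal M(Z)$; 3. for every $\phi\in\Phi$, the leading monomial $\bar\phi$ has no subword in $\mathcal M(X)\setminus(X\cup\{1\})$; 4. for every $\phi(x_1,\dots,x_n)\in\Phi$ and all $u_1,\dots,u_n\in\mathfrak M(Z)$, the element $\phi(u_1,\dots,u_n)$ is $0$ or has leading monomial $\bar\phi(u_1,\dots,u_n)$ with respect to $\le$. Then $S_\Phi(\mathfrak M(Z))\cup G$ is an $\Omega$-GS basis of $\langle S_\Phi(\mathfrak M(Z))\cup I_A\rangle_\Omega$ in $k\mathfrak M(Z)$ with respect to $\le$; that is, it is an $\Omega$-GS basis in $k\mathfrak M(Z)$ and it generates this $\Omega$-ideal. -/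

import Mathlib

universe u₁ u₂ u₃ u₄

/-- The free `Ω`-monoid `𝔐(Z)`: words (finite sequences) whose letters are elements of `Z` or
bracketed words `⌊u⌋_ω` with `ω ∈ Ω` and `u ∈ 𝔐(Z)`.  A word is the empty word `1`, or a letter
`z ∈ Z` followed by a word `w`, or a letter `⌊u⌋_ω` followed by a word `w`. -/
inductive OpWord (Ω : Type u₁) (Z : Type u₂) : Type (max u₁ u₂) where
  | nil : OpWord Ω Z
  | consVar (z : Z) (w : OpWord Ω Z) : OpWord Ω Z
  | consBr (ω : Ω) (u w : OpWord Ω Z) : OpWord Ω Z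

namespace OpWord

section Basic

variable {Ω : Type u₁} {Z : Type u₂} {Y : Type u₃}

/-- Concatenation of words. -/
def append : OpWord Ω Z → OpWord Ω Z → OpWord Ω Z
  | nil, w' => w'
  | consVar z w, w' => consVar z (append w w')
  | consBr ω u w, w' => consBr ω u (append w w')

instance : One (OpWord Ω Z) := ⟨nil⟩

instance : Mul (OpWord Ω Z) := ⟨append⟩

theorem nil_eq_one : (nil : OpWord Ω Z) = 1 := rfl

@[simp] theorem consVar_mul (z : Z) (w w' : OpWord Ω Z) :
    consVar z w * w' = consVar z (w * w') := rfl

@[simp] theorem consBr_mul (ω : Ω) (u w w' : OpWord Ω Z) :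
    consBr ω u w * w' = consBr ω u (w * w') := rfl

theorem nil_mul' (w : OpWord Ω Z) : (nil : OpWord Ω Z) * w = w := rfl

theorem mul_nil' (w : OpWord Ω Z) : w * (nil : OpWord Ω Z) = w := by
  induction w with
  | nil => rfl
  | consVar z w ih => rw [consVar_mul, ih]
  | consBr ω u w _ ih => rw [consBr_mul, ih]

theorem mul_assoc' (a b c : OpWord Ω Z) : a * b * c = a * (b * c) := by
  induction a with
  | nil => rfl
  | consVar z w ih => rw [consVar_mul, consVar_mul, consVar_mul, ih]
  | consBr ω u w _ ih => rw [consBr_mul, consBr_mul, consBr_mul, ih]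

instance : Monoid (OpWord Ω Z) where
  mul_assoc := mul_assoc'
  one_mul := nil_mul'
  mul_one := mul_nil'

/-- The letter `z ∈ Z` as a word. -/
def var (z : Z) : OpWord Ω Z := consVar z nil

/-- The operator `u ↦ ⌊u⌋_ω` on words. -/
def br (ω : Ω) (u : OpWord Ω Z) : OpWord Ω Z := consBr ω u nil

/-- The breadth `|w|`: the number of letters of `w` at the outermost level. -/
def breadth : OpWord Ω Z → ℕ
  | nil => 0
  | consVar _ w => breadth w + 1
  | consBr _ _ w => breadth w + 1

/-- Substitution `w(σ)`: every letter `z ∈ Z` of `w`, at any depth, is replaced by the word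
`σ z`. This is the morphism of `Ω`-monoids that extends `σ`. -/
def subst (σ : Z → OpWord Ω Y) : OpWord Ω Z → OpWord Ω Y
  | nil => 1
  | consVar z w => σ z * subst σ w
  | consBr ω u w => br ω (subst σ u) * subst σ w

open Classical in
/-- The number of occurrences, at any depth, of the letter `z` in a word. -/
noncomputable def occ (z : Z) : OpWord Ω Z → ℕ
  | nil => 0
  | consVar z' w => (if z' = z then 1 else 0) + occ z w
  | consBr _ u w => occ z u + occ z w

variable (Ω) in
/-- The inclusion of the free monoid `𝓜(Z)` into `𝔐(Z)`, as the words without brackets. -/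
def ofFree : FreeMonoid Z →* OpWord Ω Z := FreeMonoid.lift var

theorem ofFree_injective : Function.Injective (ofFree Ω : FreeMonoid Z → OpWord Ω Z) := by
  intro a
  induction a using FreeMonoid.recOn with
  | one =>
    intro b h
    cases b using FreeMonoid.casesOn with
    | one => rfl
    | of_mul y ys =>
      rw [map_one, map_mul] at h
      exact OpWord.noConfusion rfl rfl (heq_of_eq h)
  | of_mul x xs ihx =>
    intro b h
    cases b using FreeMonoid.casesOn with
    | one =>
      rw [map_one, map_mul] at h
      exact OpWord.noConfusion rfl rfl (heq_of_eq h)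
    | of_mul y ys =>
      have h' : consVar x (ofFree Ω xs) = consVar y (ofFree Ω ys) := by
        rw [map_mul, map_mul] at h
        exact h
      obtain ⟨rfl, h2⟩ := OpWord.consVar.inj h'
      rw [ihx h2]

end Basic

end OpWord

/-- `𝔐⋆(Z)`: words over `Z ∪ {⋆}` in which `⋆` (here `none`) occurs exactly once. -/
def StarWord (Ω : Type u₁) (Z : Type u₂) : Type (max u₁ u₂) :=
  {q : OpWord Ω (Option Z) // q.occ none = 1}

/-- `q|_u`: the symbol `⋆` of `q` is replaced by the word `u`. -/
def StarWord.plug {Ω : Type u₁} {Z : Type u₂} (q : StarWord Ω Z) (u : OpWord Ω Z) :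
    OpWord Ω Z :=
  q.1.subst (fun o => o.elim u OpWord.var)

/-- `u` is a subword of `w`: `w = q|_u` for some `q ∈ 𝔐⋆(Z)`. -/
def IsSubword {Ω : Type u₁} {Z : Type u₂} (u w : OpWord Ω Z) : Prop :=
  ∃ q : StarWord Ω Z, w = q.plug u

/-- The given linear order on `𝔐(Z)` is a monomial order: a well-order such that `u < v` implies
`q|_u < q|_v` for all `q ∈ 𝔐⋆(Z)`. -/
structure IsMonomialOrder (Ω : Type u₁) (Z : Type u₂) [LinearOrder (OpWord Ω Z)] : Prop where
  wf : WellFounded (fun u v : OpWord Ω Z => u < v)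
  plug_lt : ∀ (q : StarWord Ω Z) (u v : OpWord Ω Z), u < v → q.plug u < q.plug v

/-- The restriction to `𝓜(Z)` of a linear order on `𝔐(Z)`. -/
@[reducible] def restrictOrder (Ω : Type u₁) (Z : Type u₂) [LinearOrder (OpWord Ω Z)] :
    LinearOrder (FreeMonoid Z) :=
  LinearOrder.lift' (OpWord.ofFree Ω) OpWord.ofFree_injective

noncomputable section Leading

variable {k : Type u₁} [Field k] {M : Type u₂} [Monoid M] [LinearOrder M]

open Classical in
/-- The leading monomial of `f ∈ kM`: the largest monomial that appears in `f`, and `1` if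
`f = 0`. (For a nonzero constant it is `1` as well.) -/
def leadMon (f : MonoidAlgebra k M) : M :=
  if h : f.coeff.support.Nonempty then f.coeff.support.max' h else 1

/-- The leading coefficient of `f`. -/
def leadCoeff (f : MonoidAlgebra k M) : k := f.coeff (leadMon f)

/-- `f` divided by its leading coefficient (and `0` for `f = 0`). -/
def monicize (f : MonoidAlgebra k M) : MonoidAlgebra k M := (leadCoeff f)⁻¹ • f

variable {C : Type u₃} (plug : C → M → M)

/-- `f` is trivial modulo `(𝒢, p)`: it is a finite sum `∑ cᵢ qᵢ|_{sᵢ}` with `cᵢ ∈ k`,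
`sᵢ ∈ 𝒢` and `qᵢ|_{s̄ᵢ} < p`. Here `C` is the set of words with one hole that is in use, and
`plug q u` is `q|_u`. -/
def TrivialMod (𝒢 : Set (MonoidAlgebra k M)) (p : M) (f : MonoidAlgebra k M) : Prop :=
  f ∈ Submodule.span k {h : MonoidAlgebra k M |
    ∃ q : C, ∃ s ∈ 𝒢, plug q (leadMon s) < p ∧ h = MonoidAlgebra.mapDomain (plug q) s}

/-- All intersection compositions `f u - v g` with respect to `p = f̄ u = v ḡ`, where
`max {|f̄|, |ḡ|} < |p| < |f̄| + |ḡ|`, and all inclusion compositions `f - q|_g` with respect to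
`p = f̄ = q|_ḡ`, of the monic polynomials `f`, `g` obtained by normalizing two nonzero elements
of `𝒢`, are trivial modulo `(𝒢, p)`. Here `len` is the length of words. -/
def AllCompositionsTrivial (len : M → ℕ) (𝒢 : Set (MonoidAlgebra k M)) : Prop :=
  ∀ f₀ ∈ 𝒢, ∀ g₀ ∈ 𝒢, f₀ ≠ 0 → g₀ ≠ 0 →
    ∀ f g : MonoidAlgebra k M, f = monicize f₀ → g = monicize g₀ →
      (∀ p u v : M, p = leadMon f * u → p = v * leadMon g →
        max (len (leadMon f)) (len (leadMon g)) < len p →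
        len p < len (leadMon f) + len (leadMon g) →
        TrivialMod plug 𝒢 p (f * MonoidAlgebra.of k M u - MonoidAlgebra.of k M v * g)) ∧
      (∀ (p : M) (q : C), p = leadMon f → p = plug q (leadMon g) →
        TrivialMod plug 𝒢 p (f - MonoidAlgebra.mapDomain (plug q) g))

end Leading

/-- `𝒢 ⊆ k𝔐(Z)` is an `Ω`-Gröbner–Shirshov basis in `k𝔐(Z)` for the given order on `𝔐(Z)`. -/
def IsOmegaGSBasis {k : Type u₁} [Field k] {Ω : Type u₂} {Z : Type u₃}
    [LinearOrder (OpWord Ω Z)] (𝒢 : Set (MonoidAlgebra k (OpWord Ω Z))) : Prop :=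
  AllCompositionsTrivial (C := StarWord Ω Z) StarWord.plug OpWord.breadth 𝒢

/-- `G ⊆ k𝓜(Z)` is a (usual, associative) Gröbner–Shirshov basis in `k𝓜(Z)` for the given order
on `𝓜(Z)`. A word with one hole in `𝓜⋆(Z)` is `a ⋆ b` with `a, b ∈ 𝓜(Z)`. -/
def IsGSBasis {k : Type u₁} [Field k] {Z : Type u₂} [LinearOrder (FreeMonoid Z)]
    (G : Set (MonoidAlgebra k (FreeMonoid Z))) : Prop :=
  AllCompositionsTrivial (C := FreeMonoid Z × FreeMonoid Z) (fun q w => q.1 * w * q.2)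
    FreeMonoid.length G

/-- `φ ∈ k𝔐(X)` is a (multilinear) operated polynomial identity `φ(x₁, …, xₙ)`, `n ≥ 1`: for the
finite nonempty set `s = {x₁, …, xₙ}` of variables, every monomial of `φ` contains each variable of
`s` exactly once and no other variable. -/
def IsOPI {k : Type u₁} [Field k] {Ω : Type u₂} {X : Type u₃}
    (φ : MonoidAlgebra k (OpWord Ω X)) : Prop :=
  ∃ s : Finset X, s.Nonempty ∧ ∀ m ∈ φ.coeff.support,
    (∀ x ∈ s, m.occ x = 1) ∧ ∀ x ∉ s, m.occ x = 0

noncomputable section OPI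

variable {k : Type u₁} [Field k] {Ω : Type u₂} {X : Type u₃} {Z : Type u₄}

/-- `φ(u₁, …, uₙ)`: each variable `x` is replaced by the word `σ x`. -/
def evalOPI (σ : X → OpWord Ω Z) (φ : MonoidAlgebra k (OpWord Ω X)) :
    MonoidAlgebra k (OpWord Ω Z) :=
  MonoidAlgebra.mapDomain (OpWord.subst σ) φ

/-- `S_Φ(Y)`: all `φ(u₁, …, uₙ)` with `φ ∈ Φ` and `u₁, …, uₙ ∈ Y`. -/
def substSet (Φ : Set (MonoidAlgebra k (OpWord Ω X))) (Y : Set (OpWord Ω Z)) :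
    Set (MonoidAlgebra k (OpWord Ω Z)) :=
  {h | ∃ φ ∈ Φ, ∃ σ : X → OpWord Ω Z, (∀ x, σ x ∈ Y) ∧ h = evalOPI σ φ}

/-- `Φ` is `Ω`-GS on `k𝔐(Z)` for the given order on `𝔐(Z)`. -/
def IsOmegaGSOn [LinearOrder (OpWord Ω Z)] (Φ : Set (MonoidAlgebra k (OpWord Ω X))) : Prop :=
  IsOmegaGSBasis (substSet Φ (Set.univ : Set (OpWord Ω Z)))

/-- The `k`-linear operator `P_ω` on `k𝔐(Z)` with `P_ω(u) = ⌊u⌋_ω` for words `u`. -/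
def opMap (k : Type u₁) [Field k] (ω : Ω) (f : MonoidAlgebra k (OpWord Ω Z)) :
    MonoidAlgebra k (OpWord Ω Z) :=
  MonoidAlgebra.mapDomain (OpWord.br ω) f

/-- An `Ω`-ideal of `k𝔐(Z)`: a two-sided ideal closed under all operators. -/
def IsOmegaIdeal (I : TwoSidedIdeal (MonoidAlgebra k (OpWord Ω Z))) : Prop :=
  ∀ (ω : Ω) (f : MonoidAlgebra k (OpWord Ω Z)), f ∈ I → opMap k ω f ∈ I

/-- The `Ω`-ideal of `k𝔐(Z)` generated by `S`. -/
def omegaSpan (S : Set (MonoidAlgebra k (OpWord Ω Z))) :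
    TwoSidedIdeal (MonoidAlgebra k (OpWord Ω Z)) :=
  sInf {I | IsOmegaIdeal I ∧ ∀ f ∈ S, f ∈ I}

/-- The inclusion `k𝓜(Z) ⊆ k𝔐(Z)`. -/
def inclFree (k : Type u₁) [Field k] (Ω : Type u₂) {Z : Type u₄} :
    MonoidAlgebra k (FreeMonoid Z) → MonoidAlgebra k (OpWord Ω Z) :=
  MonoidAlgebra.mapDomain (OpWord.ofFree Ω)

end OPI

/-! Pairs of elements of the union are of four kinds. Two values of OPIs compose trivially by
assumption.

Two elements of `G` have bracket-free leading monomials, so their occurrences in a word of `𝔐(Z)`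
either lie in one bracket level, where the associative compositions decide, or are disjoint
(`IsGSBasis.trivialMod_plug_sub_plug`). This gives a composition-diamond lemma for `G` inside
`k𝔐(Z)` (`trivialMod_of_mem_span`).

Let `f = φ(σ)` and `g ∈ G`. If `f̄ = q|_ḡ` with `ḡ ≠ 1`, the absence of adjacent variables in `φ̄`
puts some occurrence of `ḡ` inside one value, `σ x = d|_ḡ`. Inserting monic `g` for `ḡ` there gives
a linear expression lying in the ideal of `G`. It differs from `f` by values of `φ` with smaller
leading monomials, and the diamond lemma absorbs the rest (`trivialMod_evalOPI_sub_plug`). If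
instead `ḡ = q|_f̄`, then `φ̄` is bracket-free, hence a single variable, so every word is the
leading monomial of a value of `φ` and everything below `ḡ` reduces to zero.

For an intersection `f̄u = vḡ`, the overlap is bracket-free and nonempty, so `φ̄` ends in a variable
`x`. With `f'` the value of `φ` after `σ x` is replaced by `(σ x)u`, one has `fu - vg = (f' - vg) -
(f' - fu)` for the monic versions, a difference of two inclusion compositions. The mirror case is
the same.

This needs `f' ≠ 0`, the delicate point, as values of OPIs may vanish by cancellation. Polarize:
give every letter occurrence in the arguments its own variable. If the polarized element is nonzero
but vanishes at letters, another of its monomials is its leading one with variables renamed by some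
`π`. The leading monomial sits at the same place for all substitutions, so iterating `π` on suitable
arguments gives an infinite descent (`eq_zero_of_evalOPI_var_eq_zero`). Thus the polarized element
is zero, and so is its specialization `f`. -/

/-! ### Leading monomials, monic elements and triviality modulo `(𝒢, p)` -/

section LeadingMonomials

open MonoidAlgebra

variable {k : Type u₁} [Field k] {M : Type u₂} {N : Type u₃}

theorem mapDomain_mem_supported {f : M → N} {s : Set M} {t : Set N} (h : ∀ m ∈ s, f m ∈ t)
    {x : MonoidAlgebra k M} (hx : x ∈ supported k k s) : mapDomain f x ∈ supported k k t := by
  classical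
  rw [mem_supported] at hx ⊢
  intro n hn
  obtain ⟨m, hm, rfl⟩ := Finset.mem_image.1 (Finsupp.mapDomain_support hn)
  exact h m (hx hm)

theorem mapDomain_sub' (f : M → N) (x y : MonoidAlgebra k M) :
    mapDomain f (x - y) = mapDomain f x - mapDomain f y :=
  map_sub (mapDomainLinearMap k k f) x y

theorem mapDomain_smul' (f : M → N) (c : k) (x : MonoidAlgebra k M) :
    mapDomain f (c • x) = c • mapDomain f x :=
  map_smul (mapDomainLinearMap k k f) c x

theorem mapDomain_mapDomain {P : Type*} (f : M → N) (g : N → P) (x : MonoidAlgebra k M) :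
    mapDomain g (mapDomain f x) = mapDomain (g ∘ f) x := by
  apply coeff_injective
  exact Finsupp.mapDomain_comp.symm

theorem mapDomain_congr' {f g : M → N} {x : MonoidAlgebra k M}
    (h : ∀ m ∈ x.coeff.support, f m = g m) : mapDomain f x = mapDomain g x := by
  apply coeff_injective
  exact Finsupp.mapDomain_congr h

/-- No other monomial of `x` collides with `m₀`, so nothing is added to its coefficient. Global
injectivity of `f` would be too much to ask: substitutions may merge other monomials. -/
theorem coeff_mapDomain_eq {f : M → N} {x : MonoidAlgebra k M} {m₀ : M}
    (h : ∀ m ∈ x.coeff.support, f m = f m₀ → m = m₀) :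
    (mapDomain f x).coeff (f m₀) = x.coeff m₀ := by
  classical
  have h1 : x.erase m₀ ∈ supported k k {m | m ∈ x.coeff.support ∧ m ≠ m₀} := by
    rw [mem_supported]
    intro m hm
    rw [coeff_erase, Finsupp.support_erase, Finset.mem_coe, Finset.mem_erase] at hm
    exact ⟨hm.2, hm.1⟩
  have h2 := mapDomain_mem_supported (f := f) (t := {f m₀}ᶜ)
    (fun m hm h' => hm.2 (h m hm.1 h')) h1
  have h3 := mem_supported'.1 h2 (f m₀) (by simp)
  conv_lhs => rw [← single_add_erase m₀ x]
  rw [mapDomain_add, mapDomain_single, coeff_add, Finsupp.add_apply, h3, add_zero, coeff_single,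
    Finsupp.single_eq_same]

theorem mapDomain_mul_right [Monoid M] (u : M) (f : MonoidAlgebra k M) :
    mapDomain (fun m => m * u) f = f * of k M u := by
  induction f using MonoidAlgebra.induction_linear with
  | zero => simp
  | add f g hf hg => rw [mapDomain_add, hf, hg, add_mul]
  | single m r => simp [single_mul_single]

theorem mapDomain_mul_left [Monoid M] (u : M) (f : MonoidAlgebra k M) :
    mapDomain (fun m => u * m) f = of k M u * f := by
  induction f using MonoidAlgebra.induction_linear with
  | zero => simp
  | add f g hf hg => rw [mapDomain_add, hf, hg, mul_add]
  | single m r => simp [single_mul_single]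

variable [LinearOrder M]

/-- `f` is monic with leading monomial `w`. -/
def IsMonicLead (f : MonoidAlgebra k M) (w : M) : Prop :=
  f - single w 1 ∈ supported k k (Set.Iio w)

theorem IsMonicLead.mapDomain [LinearOrder N] {f : MonoidAlgebra k M} {w : M}
    (h : IsMonicLead f w) {F : M → N} (hF : StrictMono F) :
    IsMonicLead (MonoidAlgebra.mapDomain F f) (F w) := by
  have := mapDomain_mem_supported (k := k) (f := F) (t := Set.Iio (F w))
    (fun m hm => hF hm) h
  rwa [mapDomain_sub', mapDomain_single] at this

theorem IsMonicLead.sub {f g : MonoidAlgebra k M} {w : M} (hf : IsMonicLead f w)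
    (hg : IsMonicLead g w) : f - g ∈ supported k k (Set.Iio w) := by
  have := Submodule.sub_mem _ hf hg
  simpa using this

theorem IsMonicLead.coeff_eq_one {f : MonoidAlgebra k M} {w : M} (h : IsMonicLead f w) :
    f.coeff w = 1 := by
  have := mem_supported'.1 h w (lt_irrefl w)
  simpa [sub_eq_zero] using this

theorem IsMonicLead.mem_supported_Iic {f : MonoidAlgebra k M} {w : M} (h : IsMonicLead f w) :
    f ∈ supported k k (Set.Iic w) := by
  have h1 : f - single w 1 ∈ supported k k (Set.Iic w) :=
    supported_mono Set.Iio_subset_Iic_self h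
  have h2 : single w (1 : k) ∈ supported k k (Set.Iic w) := by
    rw [mem_supported']
    intro m hm
    rw [coeff_single, Finsupp.single_apply, if_neg]
    rintro rfl
    exact hm le_rfl
  simpa using Submodule.add_mem _ h1 h2

variable [Monoid M]

theorem coeff_leadMon_ne_zero {f : MonoidAlgebra k M} (hf : f ≠ 0) : f.coeff (leadMon f) ≠ 0 := by
  classical
  have h : f.coeff.support.Nonempty := by
    rw [Finsupp.support_nonempty_iff]
    simpa using hf
  rw [leadMon, dif_pos h]
  exact Finsupp.mem_support_iff.1 (Finset.max'_mem _ h)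

theorem leadMon_mem_support {f : MonoidAlgebra k M} (hf : f ≠ 0) :
    leadMon f ∈ f.coeff.support :=
  Finsupp.mem_support_iff.2 (coeff_leadMon_ne_zero hf)

theorem le_leadMon {f : MonoidAlgebra k M} {m : M} (hm : m ∈ f.coeff.support) :
    m ≤ leadMon f := by
  classical
  rw [leadMon, dif_pos ⟨m, hm⟩]
  exact Finset.le_max' _ _ hm

theorem leadMon_eq {f : MonoidAlgebra k M} {w : M} (hw : f.coeff w ≠ 0)
    (h : ∀ m ∈ f.coeff.support, m ≤ w) : leadMon f = w := by
  have hf : f ≠ 0 := by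
    rintro rfl
    simp at hw
  exact le_antisymm (h _ (leadMon_mem_support hf)) (le_leadMon (Finsupp.mem_support_iff.2 hw))

theorem IsMonicLead.leadMon_eq {f : MonoidAlgebra k M} {w : M} (h : IsMonicLead f w) :
    leadMon f = w :=
  _root_.leadMon_eq (by rw [h.coeff_eq_one]; exact one_ne_zero)
    fun _ hm => mem_supported.1 h.mem_supported_Iic hm

theorem leadCoeff_ne_zero {f : MonoidAlgebra k M} (hf : f ≠ 0) : leadCoeff f ≠ 0 :=
  coeff_leadMon_ne_zero hf

theorem leadCoeff_smul_monicize {f : MonoidAlgebra k M} (hf : f ≠ 0) :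
    leadCoeff f • monicize f = f := by
  rw [monicize, smul_smul, mul_inv_cancel₀ (leadCoeff_ne_zero hf), one_smul]

theorem monicize_isMonicLead {f : MonoidAlgebra k M} (hf : f ≠ 0) :
    IsMonicLead (monicize f) (leadMon f) := by
  rw [IsMonicLead, mem_supported']
  intro m hm
  rw [coeff_sub, Finsupp.sub_apply, monicize, coeff_smul, Finsupp.smul_apply, coeff_single,
    Finsupp.single_apply]
  by_cases h : leadMon f = m
  · rw [if_pos h, ← h, smul_eq_mul, ← leadCoeff, inv_mul_cancel₀ (leadCoeff_ne_zero hf), sub_self]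
  · rw [if_neg h, sub_zero]
    have : f.coeff m = 0 := by
      by_contra h0
      exact hm (lt_of_le_of_ne (le_leadMon (Finsupp.mem_support_iff.2 h0)) (Ne.symm h))
    rw [this, smul_zero]

theorem leadMon_monicize {f : MonoidAlgebra k M} (hf : f ≠ 0) :
    leadMon (monicize f) = leadMon f := (monicize_isMonicLead hf).leadMon_eq

theorem mapDomain_monicize {N : Type u₃} [Monoid N] [LinearOrder N] {F : M → N}
    (hF : StrictMono F) {f : MonoidAlgebra k M} (hf : f ≠ 0) :
    monicize (MonoidAlgebra.mapDomain F f) = MonoidAlgebra.mapDomain F (monicize f) ∧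
      leadMon (MonoidAlgebra.mapDomain F f) = F (leadMon f) := by
  have hco : ∀ m, (MonoidAlgebra.mapDomain F f).coeff (F m) = f.coeff m := fun m =>
    Finsupp.mapDomain_apply hF.injective _ _
  have hl : leadMon (MonoidAlgebra.mapDomain F f) = F (leadMon f) := by
    refine leadMon_eq (by rw [hco]; exact coeff_leadMon_ne_zero hf) fun m hm => ?_
    have : f ∈ supported k k (Set.Iic (leadMon f)) :=
      mem_supported.2 fun m hm => le_leadMon hm
    exact mem_supported.1 (mapDomain_mem_supported (t := Set.Iic (F (leadMon f)))
      (fun m hm => hF.monotone hm) this) hm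
  refine ⟨?_, hl⟩
  rw [monicize, monicize, mapDomain_smul', leadCoeff, hl, hco, leadCoeff]

section Trivial

variable {C : Type u₃} {plug : C → M → M} {𝒢 : Set (MonoidAlgebra k M)} {p : M}

theorem TrivialMod.zero : TrivialMod plug 𝒢 p 0 := Submodule.zero_mem _

theorem TrivialMod.add {f g : MonoidAlgebra k M} (hf : TrivialMod plug 𝒢 p f)
    (hg : TrivialMod plug 𝒢 p g) : TrivialMod plug 𝒢 p (f + g) := Submodule.add_mem _ hf hg

theorem TrivialMod.sub {f g : MonoidAlgebra k M} (hf : TrivialMod plug 𝒢 p f)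
    (hg : TrivialMod plug 𝒢 p g) : TrivialMod plug 𝒢 p (f - g) := Submodule.sub_mem _ hf hg

theorem TrivialMod.smul (c : k) {f : MonoidAlgebra k M} (hf : TrivialMod plug 𝒢 p f) :
    TrivialMod plug 𝒢 p (c • f) := Submodule.smul_mem _ c hf

/-- Serves both to enlarge `𝒢` and to pass between `StarWord` and `Ctx` as the type of holes. -/
theorem TrivialMod.mono {D : Type u₄} {plug' : D → M → M} {𝒢' : Set (MonoidAlgebra k M)}
    {f : MonoidAlgebra k M} (hf : TrivialMod plug 𝒢 p f) (h𝒢 : 𝒢 ⊆ 𝒢')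
    (h : ∀ q, ∃ q', plug q = plug' q') : TrivialMod plug' 𝒢' p f := by
  refine Submodule.span_mono ?_ hf
  rintro _ ⟨q, s, hs, hlt, rfl⟩
  obtain ⟨q', hq'⟩ := h q
  exact ⟨q', s, h𝒢 hs, hq' ▸ hlt, hq' ▸ rfl⟩

theorem TrivialMod.of_lt (q : C) {s : MonoidAlgebra k M} (hs : s ∈ 𝒢)
    (h : plug q (leadMon s) < p) : TrivialMod plug 𝒢 p (mapDomain (plug q) s) :=
  Submodule.subset_span ⟨q, s, hs, h, rfl⟩

theorem TrivialMod.monicize_of_lt (q : C) {s : MonoidAlgebra k M} (hs : s ∈ 𝒢)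
    (h : plug q (leadMon s) < p) : TrivialMod plug 𝒢 p (mapDomain (plug q) (monicize s)) := by
  rw [monicize, mapDomain_smul']
  exact (TrivialMod.of_lt q hs h).smul _

theorem TrivialMod.map {N : Type u₄} [Monoid N] [LinearOrder N] {D : Type*} {plug' : D → N → N}
    {ℋ : Set (MonoidAlgebra k N)} {F : M → N} {f : MonoidAlgebra k M}
    (hf : TrivialMod plug 𝒢 p f)
    (h : ∀ q, ∀ s ∈ 𝒢, plug q (leadMon s) < p →
      TrivialMod plug' ℋ (F p) (mapDomain F (mapDomain (plug q) s))) :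
    TrivialMod plug' ℋ (F p) (mapDomain F f) := by
  have : Submodule.span k {h : MonoidAlgebra k M |
      ∃ q : C, ∃ s ∈ 𝒢, plug q (leadMon s) < p ∧ h = MonoidAlgebra.mapDomain (plug q) s} ≤
      (Submodule.span k {h : MonoidAlgebra k N |
      ∃ q : D, ∃ s ∈ ℋ, plug' q (leadMon s) < F p ∧
        h = MonoidAlgebra.mapDomain (plug' q) s}).comap (mapDomainLinearMap k k F) := by
    rw [Submodule.span_le]
    rintro _ ⟨q, s, hs, hlt, rfl⟩
    exact h q s hs hlt
  exact this hf

theorem TrivialMod.of_supported {N : Type u₄} {s : Set N} {f : MonoidAlgebra k N}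
    (Λ : MonoidAlgebra k N →ₗ[k] MonoidAlgebra k M) (hf : f ∈ supported k k s)
    (h : ∀ m ∈ s, TrivialMod plug 𝒢 p (Λ (single m 1))) : TrivialMod plug 𝒢 p (Λ f) := by
  have : supported k k s ≤ (Submodule.span k {h : MonoidAlgebra k M |
      ∃ q : C, ∃ s ∈ 𝒢, plug q (leadMon s) < p ∧
        h = MonoidAlgebra.mapDomain (plug q) s}).comap Λ := by
    rw [supported_eq_span_single, Submodule.span_le]
    rintro _ ⟨m, hm, rfl⟩
    exact h m hm
  exact this hf

/-- If every word is the leading monomial of some `q|_s`, then every element with monomials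
`< p` is trivial modulo `(𝒢, p)`. -/
theorem trivialMod_of_forall_lead (hwf : WellFounded (fun u v : M => u < v))
    (hplug : ∀ q, StrictMono (plug q))
    (h : ∀ t, ∃ q, ∃ s ∈ 𝒢, s ≠ 0 ∧ plug q (leadMon s) = t) {f : MonoidAlgebra k M}
    (hf : f ∈ supported k k (Set.Iio p)) : TrivialMod plug 𝒢 p f := by
  have key : ∀ t, t < p → TrivialMod plug 𝒢 p (single t 1) := by
    intro t
    induction t using hwf.induction with
    | _ t ih =>
    intro ht
    obtain ⟨q, s, hs, hs0, rfl⟩ := h t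
    -- The word is the monic `q|_s` minus a tail of strictly smaller words, which are trivial by
    -- induction.
    have h1 := TrivialMod.monicize_of_lt q hs ht
    have h2 := (monicize_isMonicLead hs0).mapDomain (hplug q)
    have h3 := TrivialMod.of_supported (plug := plug) (𝒢 := 𝒢) (p := p)
      LinearMap.id h2 (fun m hm => ih m hm (lt_trans hm ht))
    simpa using h1.sub h3
  exact TrivialMod.of_supported LinearMap.id hf key

theorem TrivialMod.mem_supported (hplug : ∀ q, StrictMono (plug q)) {f : MonoidAlgebra k M}
    (hf : TrivialMod plug 𝒢 p f) : f ∈ supported k k (Set.Iio p) := by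
  have : Submodule.span k {h : MonoidAlgebra k M |
      ∃ q : C, ∃ s ∈ 𝒢, plug q (leadMon s) < p ∧ h = MonoidAlgebra.mapDomain (plug q) s} ≤
      supported k k (Set.Iio p) := by
    rw [Submodule.span_le]
    rintro _ ⟨q, s, hs, hlt, rfl⟩
    have hs' : s ∈ supported k k (Set.Iic (leadMon s)) :=
      MonoidAlgebra.mem_supported.2 fun m hm => le_leadMon hm
    exact mapDomain_mem_supported (t := Set.Iio p)
      (fun m hm => lt_of_le_of_lt ((hplug q).monotone hm) hlt) hs'
  exact this hf

end Trivial

end LeadingMonomials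

/-! ### Words: substitution, occurrences, Levi's lemma, bracket-free words -/

namespace OpWord

variable {Ω : Type u₁} {X : Type u₂} {Y : Type u₃} {Z : Type u₄}

@[simp] theorem subst_one (σ : X → OpWord Ω Y) : (1 : OpWord Ω X).subst σ = 1 := rfl

@[simp] theorem subst_consVar (σ : X → OpWord Ω Y) (x : X) (w : OpWord Ω X) :
    (consVar x w).subst σ = σ x * w.subst σ := rfl

@[simp] theorem subst_consBr (σ : X → OpWord Ω Y) (ω : Ω) (u w : OpWord Ω X) :
    (consBr ω u w).subst σ = consBr ω (u.subst σ) (w.subst σ) := rfl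

@[simp] theorem subst_nil (σ : X → OpWord Ω Y) : (nil : OpWord Ω X).subst σ = 1 := rfl

theorem consVar_eq (x : X) (w : OpWord Ω X) : consVar x w = var x * w := rfl

theorem consBr_eq (ω : Ω) (u w : OpWord Ω X) : consBr ω u w = br ω u * w := rfl

@[simp] theorem subst_mul (σ : X → OpWord Ω Y) (a b : OpWord Ω X) :
    (a * b).subst σ = a.subst σ * b.subst σ := by
  induction a with
  | nil => rfl
  | consVar x w ih => rw [consVar_mul, subst_consVar, subst_consVar, ih, mul_assoc]
  | consBr ω u w _ ih => rw [consBr_mul, subst_consBr, subst_consBr, ih, consBr_mul]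

@[simp] theorem subst_var (σ : X → OpWord Ω Y) (x : X) : (var x).subst σ = σ x := mul_one _

@[simp] theorem subst_br (σ : X → OpWord Ω Y) (ω : Ω) (u : OpWord Ω X) :
    (br ω u).subst σ = br ω (u.subst σ) := rfl

theorem subst_subst (σ : X → OpWord Ω Y) (τ : Y → OpWord Ω Z) (w : OpWord Ω X) :
    (w.subst σ).subst τ = w.subst fun x => (σ x).subst τ := by
  induction w with
  | nil => rfl
  | consVar x w ih => rw [subst_consVar, subst_mul, ih, subst_consVar]
  | consBr ω u w ihu ih => rw [subst_consBr, subst_consBr, ihu, ih, subst_consBr]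

theorem subst_var_self (w : OpWord Ω X) : w.subst var = w := by
  induction w with
  | nil => rfl
  | consVar x w ih => rw [subst_consVar, ih, consVar_eq]
  | consBr ω u w ihu ih => rw [subst_consBr, ihu, ih]

@[simp] theorem occ_one (x : X) : occ x (1 : OpWord Ω X) = 0 := rfl

@[simp] theorem occ_nil (x : X) : occ x (nil : OpWord Ω X) = 0 := rfl

open Classical in
@[simp] theorem occ_consVar (x y : X) (w : OpWord Ω X) :
    occ x (consVar y w) = (if y = x then 1 else 0) + occ x w := by
  rw [occ]

@[simp] theorem occ_consBr (x : X) (ω : Ω) (u w : OpWord Ω X) :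
    occ x (consBr ω u w) = occ x u + occ x w := rfl

@[simp] theorem occ_mul (x : X) (a b : OpWord Ω X) : occ x (a * b) = occ x a + occ x b := by
  induction a with
  | nil => rw [nil_eq_one, one_mul, occ_one, zero_add]
  | consVar y w ih => rw [consVar_mul, occ_consVar, occ_consVar, ih, add_assoc]
  | consBr ω u w _ ih => rw [consBr_mul, occ_consBr, occ_consBr, ih, add_assoc]

open Classical in
@[simp] theorem occ_var (x y : X) : occ x (var y : OpWord Ω X) = if y = x then 1 else 0 := by
  simp [var]

@[simp] theorem occ_br (x : X) (ω : Ω) (u : OpWord Ω X) : occ x (br ω u) = occ x u := rfl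

theorem subst_congr {σ τ : X → OpWord Ω Y} {w : OpWord Ω X}
    (h : ∀ x, occ x w ≠ 0 → σ x = τ x) : w.subst σ = w.subst τ := by
  classical
  induction w with
  | nil => rfl
  | consVar x w ih =>
    rw [subst_consVar, subst_consVar, h x (by simp), ih fun y hy => h y (by simp [hy])]
  | consBr ω u w ihu ih =>
    rw [subst_consBr, subst_consBr, ihu fun y hy => h y (by simp [hy]),
      ih fun y hy => h y (by simp [hy])]

/-- Levi's lemma for words. -/
theorem mul_eq_mul {a b c d : OpWord Ω X} (h : a * b = c * d) :
    (∃ e, a = c * e ∧ d = e * b) ∨ ∃ e, c = a * e ∧ b = e * d := by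
  induction a generalizing c with
  | nil => exact Or.inr ⟨c, rfl, h⟩
  | consVar x w ih =>
    cases c with
    | nil => exact Or.inl ⟨_, rfl, h.symm⟩
    | consVar y w' =>
      obtain ⟨rfl, h'⟩ := consVar.inj h
      rcases ih h' with ⟨e, rfl, h2⟩ | ⟨e, rfl, h2⟩
      · exact Or.inl ⟨e, rfl, h2⟩
      · exact Or.inr ⟨e, rfl, h2⟩
    | consBr ω u w' => exact absurd h (by simp)
  | consBr ω u w _ ih =>
    cases c with
    | nil => exact Or.inl ⟨_, rfl, h.symm⟩
    | consVar y w' => exact absurd h (by simp)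
    | consBr ω' u' w' =>
      obtain ⟨rfl, rfl, h'⟩ := consBr.inj h
      rcases ih h' with ⟨e, rfl, h2⟩ | ⟨e, rfl, h2⟩
      · exact Or.inl ⟨e, rfl, h2⟩
      · exact Or.inr ⟨e, rfl, h2⟩

@[simp] theorem breadth_one : breadth (1 : OpWord Ω X) = 0 := rfl

@[simp] theorem breadth_mul (a b : OpWord Ω X) : breadth (a * b) = breadth a + breadth b := by
  induction a with
  | nil => rw [nil_eq_one, one_mul, breadth_one, zero_add]
  | consVar y w ih => rw [consVar_mul, breadth, breadth, ih]; omega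
  | consBr ω u w _ ih => rw [consBr_mul, breadth, breadth, ih]; omega

theorem breadth_eq_zero {a : OpWord Ω X} : breadth a = 0 ↔ a = 1 := by
  cases a <;> simp [breadth, ← nil_eq_one]

theorem mul_left_cancel' {a b c : OpWord Ω X} (h : a * b = a * c) : b = c := by
  induction a with
  | nil => exact h
  | consVar x w ih => exact ih (consVar.inj h).2
  | consBr ω u w _ ih => exact ih (consBr.inj h).2.2

theorem mul_eq_one' {a b : OpWord Ω X} (h : a * b = 1) : a = 1 ∧ b = 1 := by
  have := congrArg breadth h
  rw [breadth_mul, breadth_one] at this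
  exact ⟨breadth_eq_zero.1 (by omega), breadth_eq_zero.1 (by omega)⟩

/-- The word has no bracket, i.e. it lies in `𝓜(Z)`. -/
def BrFree : OpWord Ω X → Prop
  | nil => True
  | consVar _ w => BrFree w
  | consBr _ _ _ => False

@[simp] theorem brFree_one : BrFree (1 : OpWord Ω X) := trivial

@[simp] theorem brFree_var (x : X) : BrFree (var x : OpWord Ω X) := trivial

@[simp] theorem brFree_mul {a b : OpWord Ω X} : BrFree (a * b) ↔ BrFree a ∧ BrFree b := by
  induction a with
  | nil => simp [nil_eq_one]
  | consVar y w ih => exact ih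
  | consBr ω u w _ ih => exact ⟨False.elim, fun h => h.1.elim⟩

@[simp] theorem not_brFree_br (ω : Ω) (u : OpWord Ω X) : ¬ BrFree (br ω u) := fun h => h

@[simp] theorem not_brFree_consBr (ω : Ω) (u w : OpWord Ω X) : ¬ BrFree (consBr ω u w) :=
  fun h => h

@[simp] theorem ofFree_of (x : X) : ofFree Ω (FreeMonoid.of x) = var x :=
  FreeMonoid.lift_eval_of _ _

theorem brFree_iff {a : OpWord Ω X} : BrFree a ↔ ∃ w, ofFree Ω w = a := by
  constructor
  · intro h
    induction a with
    | nil => exact ⟨1, map_one _⟩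
    | consVar y w ih =>
      obtain ⟨v, rfl⟩ := ih h
      exact ⟨FreeMonoid.of y * v, by rw [map_mul, ofFree_of, consVar_eq]⟩
    | consBr ω u w _ ih => exact h.elim
  · rintro ⟨w, rfl⟩
    induction w using FreeMonoid.inductionOn' with
    | one => simp
    | of_mul x xs ih => simpa using ih

@[simp] theorem brFree_ofFree (w : FreeMonoid X) : BrFree (ofFree Ω w) :=
  brFree_iff.2 ⟨w, rfl⟩

theorem breadth_ofFree (w : FreeMonoid X) : breadth (ofFree Ω w) = w.length := by
  induction w using FreeMonoid.inductionOn' with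
  | one => simp
  | of_mul x xs ih => simp [ih, var, breadth, add_comm]

end OpWord

/-! ### Words with one hole as inductive data -/

/-- Words with one hole: either the hole is a letter at the outermost level, or it lies in a
bracket. -/
inductive Ctx (Ω : Type u₁) (Z : Type u₂) : Type (max u₁ u₂) where
  | flat (a b : OpWord Ω Z) : Ctx Ω Z
  | nest (a : OpWord Ω Z) (ω : Ω) (c : Ctx Ω Z) (b : OpWord Ω Z) : Ctx Ω Z

namespace Ctx

open OpWord

variable {Ω : Type u₁} {Z : Type u₂} {X : Type u₃}

/-- Filling the hole. -/
def plug : Ctx Ω Z → OpWord Ω Z → OpWord Ω Z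
  | flat a b, u => a * u * b
  | nest a ω c b, u => a * br ω (c.plug u) * b

/-- The product `d * c * e`. -/
def mul (d : OpWord Ω Z) : Ctx Ω Z → OpWord Ω Z → Ctx Ω Z
  | flat a b, e => flat (d * a) (b * e)
  | nest a ω c b, e => nest (d * a) ω c (b * e)

@[simp] theorem plug_mul (d e u : OpWord Ω Z) (c : Ctx Ω Z) :
    (mul d c e).plug u = d * c.plug u * e := by
  cases c <;> simp [mul, plug, mul_assoc]

/-- Composition of contexts. -/
def comp : Ctx Ω Z → Ctx Ω Z → Ctx Ω Z
  | flat a b, d => mul a d b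
  | nest a ω c b, d => nest a ω (c.comp d) b

@[simp] theorem plug_comp (c d : Ctx Ω Z) (u : OpWord Ω Z) :
    (c.comp d).plug u = c.plug (d.plug u) := by
  induction c with
  | flat a b => simp [comp, plug]
  | nest a ω c b ih => simp [comp, plug, ih]

/-- With the other variables frozen at `σ`, the unique occurrence of `x` is a hole. This is how
multilinearity turns substitution in one variable into filling a context, and hence into a monotone
map. -/
theorem exists_subst_eq_plug {x : X} {w : OpWord Ω X} (h : occ x w = 1) (σ : X → OpWord Ω Z) :
    ∃ c : Ctx Ω Z, ∀ τ : X → OpWord Ω Z, (∀ y, y ≠ x → τ y = σ y) →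
      w.subst τ = c.plug (τ x) := by
  classical
  have aux : ∀ {v : OpWord Ω X}, occ x v = 0 → ∀ τ : X → OpWord Ω Z,
      (∀ y, y ≠ x → τ y = σ y) → v.subst τ = v.subst σ := fun {v} hv τ hτ =>
    subst_congr fun y hy => hτ y (by rintro rfl; exact hy hv)
  induction w with
  | nil => simp at h
  | consVar y w ih =>
    rw [occ_consVar] at h
    by_cases hy : y = x
    · subst hy
      rw [if_pos rfl] at h
      refine ⟨flat 1 (w.subst σ), fun τ hτ => ?_⟩
      rw [subst_consVar, aux (by omega) τ hτ, plug, one_mul]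
    · rw [if_neg hy, zero_add] at h
      obtain ⟨c, hc⟩ := ih h
      refine ⟨mul (σ y) c 1, fun τ hτ => ?_⟩
      rw [subst_consVar, plug_mul, mul_one, hc τ hτ, hτ y hy]
  | consBr ω u w ihu ih =>
    rw [occ_consBr] at h
    rcases Nat.eq_zero_or_pos (occ x u) with h0 | h0
    · obtain ⟨c, hc⟩ := ih (by omega)
      refine ⟨mul (br ω (u.subst σ)) c 1, fun τ hτ => ?_⟩
      rw [subst_consBr, plug_mul, mul_one, hc τ hτ, aux h0 τ hτ, consBr_eq]
    · obtain ⟨c, hc⟩ := ihu (by omega)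
      refine ⟨nest 1 ω c (w.subst σ), fun τ hτ => ?_⟩
      rw [subst_consBr, aux (v := w) (by omega) τ hτ, hc τ hτ, plug, one_mul, consBr_eq]

theorem exists_of_starWord (q : StarWord Ω Z) : ∃ c : Ctx Ω Z, q.plug = c.plug := by
  -- The default value `1` at `⋆` plays no role: only the values at other letters are frozen.
  obtain ⟨c, hc⟩ := exists_subst_eq_plug q.2 (fun o : Option Z => o.elim 1 OpWord.var)
  refine ⟨c, funext fun u => ?_⟩
  refine hc (fun o => o.elim u OpWord.var) fun y hy => ?_
  cases y with
  | none => exact absurd rfl hy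
  | some z => rfl

theorem exists_starWord (c : Ctx Ω Z) : ∃ q : StarWord Ω Z, c.plug = q.plug := by
  classical
  let l : OpWord Ω Z → OpWord Ω (Option Z) := fun w => w.subst fun z => var (some z)
  have hl : ∀ w, occ none (l w) = 0 := by
    intro w
    induction w with
    | nil => rfl
    | consVar z w ih => simpa [l] using ih
    | consBr ω u w ihu ih => simpa [l] using ⟨ihu, ih⟩
  have hs : ∀ w u, (l w).subst (fun o => o.elim u OpWord.var) = w := by
    intro w u
    rw [subst_subst]
    simpa using subst_var_self w
  induction c with
  | flat a b =>
    refine ⟨⟨l a * var none * l b, by simp [hl]⟩, funext fun u => ?_⟩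
    simp [StarWord.plug, hs, plug]
  | nest a ω c b ih =>
    obtain ⟨q, hq⟩ := ih
    refine ⟨⟨l a * br ω q.1 * l b, by simp [hl, q.2]⟩, funext fun u => ?_⟩
    have := congrFun hq u
    simp only [StarWord.plug] at this
    simp [StarWord.plug, hs, plug, this]

end Ctx

/-! ### Compatibility of a monomial order with contexts -/

section MonomialOrder

open OpWord

variable {Ω : Type u₁} {Z : Type u₂} [LinearOrder (OpWord Ω Z)]

theorem IsMonomialOrder.strictMono_plug (h : IsMonomialOrder Ω Z) (c : Ctx Ω Z) :
    StrictMono c.plug := by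
  obtain ⟨q, hq⟩ := c.exists_starWord
  rw [hq]
  exact fun u v huv => h.plug_lt q u v huv

theorem IsMonomialOrder.strictMono_mul (h : IsMonomialOrder Ω Z) (a b : OpWord Ω Z) :
    StrictMono fun u => a * u * b :=
  h.strictMono_plug (.flat a b)

theorem IsMonomialOrder.strictMono_mul_left (h : IsMonomialOrder Ω Z) (a : OpWord Ω Z) :
    StrictMono fun u => a * u := by
  simpa using h.strictMono_mul a 1

theorem IsMonomialOrder.strictMono_mul_right (h : IsMonomialOrder Ω Z) (b : OpWord Ω Z) :
    StrictMono fun u => u * b := by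
  simpa using h.strictMono_mul 1 b

end MonomialOrder

/-! ### Overlapping occurrences and the composition-diamond lemma -/

section CompositionDiamond

open MonoidAlgebra OpWord

variable {k : Type u₁} [Field k] {Ω : Type u₂} {Z : Type u₃}

theorem mapDomain_plug_flat (a b : OpWord Ω Z) (f : MonoidAlgebra k (OpWord Ω Z)) :
    mapDomain (Ctx.flat a b).plug f = of k _ a * f * of k _ b := by
  rw [← mapDomain_mul_left, ← mapDomain_mul_right, mapDomain_mapDomain]
  rfl

theorem mapDomain_plug_mul (a b : OpWord Ω Z) (c : Ctx Ω Z)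
    (f : MonoidAlgebra k (OpWord Ω Z)) :
    mapDomain (Ctx.mul a c b).plug f = of k _ a * mapDomain c.plug f * of k _ b := by
  rw [← mapDomain_mul_left, ← mapDomain_mul_right, mapDomain_mapDomain, mapDomain_mapDomain]
  congr 1
  funext u
  simp

theorem mapDomain_plug_comp (c d : Ctx Ω Z) (f : MonoidAlgebra k (OpWord Ω Z)) :
    mapDomain (c.comp d).plug f = mapDomain c.plug (mapDomain d.plug f) := by
  rw [mapDomain_mapDomain]
  congr 1
  funext u
  simp

variable [LinearOrder (OpWord Ω Z)] {𝒢 : Set (MonoidAlgebra k (OpWord Ω Z))}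

theorem TrivialMod.plug (hmon : IsMonomialOrder Ω Z) {p : OpWord Ω Z}
    {f : MonoidAlgebra k (OpWord Ω Z)} (hf : TrivialMod Ctx.plug 𝒢 p f) (c : Ctx Ω Z) :
    TrivialMod Ctx.plug 𝒢 (c.plug p) (mapDomain c.plug f) := by
  refine hf.map fun q s hs hlt => ?_
  rw [← mapDomain_plug_comp]
  refine TrivialMod.of_lt _ hs ?_
  rw [Ctx.plug_comp]
  exact hmon.strictMono_plug c hlt

/-- Disjoint occurrences never obstruct: for monic `F`, `G` with leading monomials `v`, `w`, one has
`F w - v G = (F - v) G - F (G - w)`, and expanding the tails `F - v` and `G - w` leaves only terms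
led by words below `v w`. -/
theorem trivialMod_disjoint (hmon : IsMonomialOrder Ω Z)
    {f g : MonoidAlgebra k (OpWord Ω Z)} (hf : f ∈ 𝒢) (hg : g ∈ 𝒢) (hf0 : f ≠ 0) (hg0 : g ≠ 0)
    (c d : Ctx Ω Z) :
    TrivialMod Ctx.plug 𝒢 (c.plug (leadMon f) * d.plug (leadMon g))
      (mapDomain (Ctx.mul 1 c (d.plug (leadMon g))).plug (monicize f) -
        mapDomain (Ctx.mul (c.plug (leadMon f)) d 1).plug (monicize g)) := by
  set v := c.plug (leadMon f)
  set w := d.plug (leadMon g)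
  have hF := (monicize_isMonicLead hf0).mapDomain (hmon.strictMono_plug c)
  have hG := (monicize_isMonicLead hg0).mapDomain (hmon.strictMono_plug d)
  rw [mapDomain_plug_mul, mapDomain_plug_mul, map_one, one_mul, mul_one]
  set F := mapDomain c.plug (monicize f) with hFdef
  set G := mapDomain d.plug (monicize g) with hGdef
  have h1 : TrivialMod Ctx.plug 𝒢 (v * w) (F * (G - single w 1)) := by
    refine TrivialMod.of_supported (LinearMap.mulLeft k F) hG fun m hm => ?_
    have : F * single m 1 = mapDomain (Ctx.mul 1 c m).plug (monicize f) := by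
      rw [mapDomain_plug_mul, map_one, one_mul]; rfl
    rw [LinearMap.mulLeft_apply, this]
    refine TrivialMod.monicize_of_lt _ hf ?_
    rw [Ctx.plug_mul, one_mul]
    exact hmon.strictMono_mul_left v hm
  have h2 : TrivialMod Ctx.plug 𝒢 (v * w) ((F - single v 1) * G) := by
    refine TrivialMod.of_supported (LinearMap.mulRight k G) hF fun m hm => ?_
    have : single m 1 * G = mapDomain (Ctx.mul m d 1).plug (monicize g) := by
      rw [mapDomain_plug_mul, map_one, mul_one]; rfl
    rw [LinearMap.mulRight_apply, this]
    refine TrivialMod.monicize_of_lt _ hg ?_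
    rw [Ctx.plug_mul, mul_one]
    exact hmon.strictMono_mul_right w hm
  have := h2.sub h1
  have e : (F - single v 1) * G - F * (G - single w 1) = F * of k _ w - of k _ v * G := by
    rw [of_apply, of_apply, sub_mul, mul_sub]; abel
  rwa [e] at this

/-- Two ways to write a word as `q|_s̄` with bracket-free leading monomials `s̄`, if both holes
are at the outermost level and the first one is not to the right of the second. -/
theorem trivialMod_flat_flat (hmon : IsMonomialOrder Ω Z)
    (hov : ∀ f ∈ 𝒢, ∀ g ∈ 𝒢, f ≠ 0 → g ≠ 0 → ∀ c d e : OpWord Ω Z,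
      leadMon f = c * d → leadMon g = d * e → c ≠ 1 → d ≠ 1 → e ≠ 1 →
      TrivialMod Ctx.plug 𝒢 (c * d * e) (monicize f * of k _ e - of k _ c * monicize g))
    (hinc : ∀ f ∈ 𝒢, ∀ g ∈ 𝒢, f ≠ 0 → g ≠ 0 → ∀ a b : OpWord Ω Z,
      leadMon f = a * leadMon g * b →
      TrivialMod Ctx.plug 𝒢 (leadMon f) (monicize f - of k _ a * monicize g * of k _ b))
    {f g : MonoidAlgebra k (OpWord Ω Z)} (hf : f ∈ 𝒢) (hg : g ∈ 𝒢) (hf0 : f ≠ 0) (hg0 : g ≠ 0)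
    (a c b₁ b₂ : OpWord Ω Z) (h : leadMon f * b₁ = c * (leadMon g * b₂)) :
    TrivialMod Ctx.plug 𝒢 (a * leadMon f * b₁)
      (mapDomain (Ctx.flat a b₁).plug (monicize f) -
        mapDomain (Ctx.flat (a * c) b₂).plug (monicize g)) := by
  simp only [mapDomain_plug_flat]
  have incl : ∀ {f g : MonoidAlgebra k (OpWord Ω Z)}, f ∈ 𝒢 → g ∈ 𝒢 → f ≠ 0 → g ≠ 0 →
      ∀ c e b : OpWord Ω Z, leadMon f = c * leadMon g * e →
      TrivialMod Ctx.plug 𝒢 (a * leadMon f * b) (of k _ a * monicize f * of k _ b -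
        of k _ (a * c) * monicize g * of k _ (e * b)) := by
    intro f g hf hg hf0 hg0 c e b h
    have := (hinc f hf g hg hf0 hg0 c e h).plug hmon (Ctx.flat a b)
    rw [mapDomain_sub', mapDomain_plug_flat, mapDomain_plug_flat] at this
    simpa only [map_mul, mul_assoc, Ctx.plug] using this
  -- Levi's lemma twice gives a proper overlap `d`, or `ḡ` inside `f̄`, or disjointness. The
  -- degenerate overlaps with `d`, `e` or `c` empty are adjacency, `ḡ` a suffix of `f̄`, and `f̄` a
  -- prefix of `ḡ`; they are not intersection compositions and are sent to the other arguments.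
  rcases mul_eq_mul h with ⟨d, hd, h'⟩ | ⟨d, rfl, rfl⟩
  · rcases mul_eq_mul h' with ⟨e, he, rfl⟩ | ⟨e, rfl, rfl⟩
    · by_cases hd1 : d = 1
      · subst hd1
        rw [one_mul] at he
        rw [mul_one] at hd
        have := trivialMod_disjoint hmon hf hg hf0 hg0 (Ctx.flat a 1) (Ctx.flat 1 b₂)
        simp only [mapDomain_plug_mul, mapDomain_plug_flat] at this
        simpa only [Ctx.plug, ← he, ← hd, mul_one, one_mul, map_one, mul_assoc, map_mul] using this
      by_cases he1 : e = 1
      · subst he1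
        rw [mul_one] at he
        subst he
        simpa using incl hf hg hf0 hg0 c 1 b₂ (by rw [hd, mul_one])
      by_cases hc1 : c = 1
      · subst hc1
        rw [one_mul] at hd
        subst hd
        have := (incl hg hf hg0 hf0 1 e b₂ (by rw [he, one_mul])).smul (-1)
        rw [he] at this
        simpa [mul_assoc] using this
      have := (hov f hf g hg hf0 hg0 c d e hd he hc1 hd1 he1).plug hmon (Ctx.flat a b₂)
      rw [mapDomain_sub', mapDomain_plug_flat, mapDomain_plug_flat] at this
      simpa only [map_mul, mul_assoc, hd, Ctx.plug] using this
    · exact incl hf hg hf0 hg0 c e b₁ (by rw [hd, mul_assoc])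
  · have := trivialMod_disjoint hmon hf hg hf0 hg0 (Ctx.flat a d) (Ctx.flat 1 b₂)
    simp only [mapDomain_plug_mul, mapDomain_plug_flat] at this
    simpa only [Ctx.plug, mul_one, one_mul, map_one, mul_assoc, map_mul] using this

/-- A nonempty bracket-free word cannot contain a bracket letter. So an occurrence at the outermost
level and one inside a bracket are disjoint, as are occurrences in two different brackets; a common
bracket is stripped by induction. What remains is two occurrences at one level. -/
theorem trivialMod_plug_sub_plug (hmon : IsMonomialOrder Ω Z)
    (hbr : ∀ f ∈ 𝒢, f ≠ 0 → BrFree (leadMon f))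
    (hne : ∀ f ∈ 𝒢, f ≠ 0 → leadMon f ≠ 1)
    (hov : ∀ f ∈ 𝒢, ∀ g ∈ 𝒢, f ≠ 0 → g ≠ 0 → ∀ c d e : OpWord Ω Z,
      leadMon f = c * d → leadMon g = d * e → c ≠ 1 → d ≠ 1 → e ≠ 1 →
      TrivialMod Ctx.plug 𝒢 (c * d * e) (monicize f * of k _ e - of k _ c * monicize g))
    (hinc : ∀ f ∈ 𝒢, ∀ g ∈ 𝒢, f ≠ 0 → g ≠ 0 → ∀ a b : OpWord Ω Z,
      leadMon f = a * leadMon g * b →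
      TrivialMod Ctx.plug 𝒢 (leadMon f) (monicize f - of k _ a * monicize g * of k _ b))
    {f g : MonoidAlgebra k (OpWord Ω Z)} (hf : f ∈ 𝒢) (hg : g ∈ 𝒢) (hf0 : f ≠ 0) (hg0 : g ≠ 0)
    (c d : Ctx Ω Z) (h : c.plug (leadMon f) = d.plug (leadMon g)) :
    TrivialMod Ctx.plug 𝒢 (c.plug (leadMon f))
      (mapDomain c.plug (monicize f) - mapDomain d.plug (monicize g)) := by
  have symm : ∀ {f g : MonoidAlgebra k (OpWord Ω Z)} {c d : Ctx Ω Z},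
      c.plug (leadMon f) = d.plug (leadMon g) →
      TrivialMod Ctx.plug 𝒢 (d.plug (leadMon g))
        (mapDomain d.plug (monicize g) - mapDomain c.plug (monicize f)) →
      TrivialMod Ctx.plug 𝒢 (c.plug (leadMon f))
        (mapDomain c.plug (monicize f) - mapDomain d.plug (monicize g)) := by
    intro f g c d h h'
    rw [h]
    simpa using h'.smul (-1)
  have flatNest : ∀ {f g : MonoidAlgebra k (OpWord Ω Z)}, f ∈ 𝒢 → g ∈ 𝒢 → f ≠ 0 → g ≠ 0 →
      ∀ (a b a' b' : OpWord Ω Z) (ω : Ω) (d : Ctx Ω Z),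
      (Ctx.flat a b).plug (leadMon f) = (Ctx.nest a' ω d b').plug (leadMon g) →
      TrivialMod Ctx.plug 𝒢 ((Ctx.flat a b).plug (leadMon f))
        (mapDomain (Ctx.flat a b).plug (monicize f) -
          mapDomain (Ctx.nest a' ω d b').plug (monicize g)) := by
    intro f g hf hg hf0 hg0 a b a' b' ω d h
    have h' := h
    simp only [Ctx.plug, mul_assoc] at h
    rcases mul_eq_mul h with ⟨e, rfl, h1⟩ | ⟨e, rfl, h1⟩
    · rcases mul_eq_mul h1 with ⟨e', he', h2⟩ | ⟨e', rfl, h2⟩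
      -- An empty `e` would make `leadMon f` empty or begin with the bracket; otherwise the bracket
      -- is the whole of `e` and lies to the left of `leadMon f`.
      · cases e with
        | nil =>
          rw [nil_eq_one, one_mul] at h1
          cases hw : leadMon f with
          | nil => exact absurd hw (hne f hf hf0)
          | consVar z w => rw [hw] at h1; exact absurd h1 (by simp [br])
          | consBr ω' u w => exact absurd (hbr f hf hf0) (by simp [hw])
        | consVar z w => exact absurd he' (by simp [br])
        | consBr ω' u w =>
          obtain ⟨rfl, rfl, hw⟩ := consBr.inj he'
          obtain ⟨rfl, rfl⟩ := mul_eq_one' hw.symm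
          rw [one_mul] at h2
          subst h2
          apply symm h'
          have := trivialMod_disjoint hmon hg hf hg0 hf0 (Ctx.nest a' ω d 1) (Ctx.flat 1 b)
          simpa [Ctx.mul, Ctx.plug, mul_assoc, br, nil_eq_one] using this
      · apply symm h'
        have := trivialMod_disjoint hmon hg hf hg0 hf0 (Ctx.nest a' ω d e') (Ctx.flat 1 b)
        subst h2
        simpa [Ctx.mul, Ctx.plug, mul_assoc] using this
    · rcases mul_eq_mul h1 with ⟨e', he', h2⟩ | ⟨e', rfl, h2⟩
      · have hb : BrFree (leadMon f) := hbr f hf hf0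
        rw [he', brFree_mul] at hb
        cases e' with
        | nil =>
          have := trivialMod_disjoint hmon hf hg hf0 hg0 (Ctx.flat a 1) (Ctx.nest 1 ω d b')
          rw [nil_eq_one, mul_one] at he'
          rw [nil_eq_one, one_mul] at h2
          subst h2 he'
          simpa [Ctx.mul, Ctx.plug, mul_assoc] using this
        | consVar z w => exact absurd h2 (by simp [br])
        | consBr ω' u w => exact hb.2.elim
      · have := trivialMod_disjoint hmon hf hg hf0 hg0 (Ctx.flat a e') (Ctx.nest 1 ω d b')
        subst h2
        simpa [Ctx.mul, Ctx.plug, mul_assoc] using this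
  induction c generalizing d with
  | flat a b =>
    cases d with
    | flat a' b' =>
      have h' := h
      simp only [Ctx.plug, mul_assoc] at h
      rcases mul_eq_mul h with ⟨e, rfl, h1⟩ | ⟨e, rfl, h1⟩
      · exact symm h' (trivialMod_flat_flat hmon hov hinc hg hf hg0 hf0 a' e b' b h1)
      · exact trivialMod_flat_flat hmon hov hinc hf hg hf0 hg0 a e b b' h1
    | nest a' ω d b' => exact flatNest hf hg hf0 hg0 a b a' b' ω d h
  | nest a ω c b ih =>
    cases d with
    | flat a' b' => exact symm h (flatNest hg hf hg0 hf0 a' b' a b ω c h.symm)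
    | nest a' ω' d b' =>
      -- As `e ≠ 1`, its first letter is the whole first bracket, so the second bracket stands to
      -- its right.
      have key : ∀ {f g : MonoidAlgebra k (OpWord Ω Z)}, f ∈ 𝒢 → g ∈ 𝒢 → f ≠ 0 → g ≠ 0 →
          ∀ (a e b b' : OpWord Ω Z) (ω ω' : Ω) (c d : Ctx Ω Z), e ≠ 1 →
          br ω (c.plug (leadMon f)) * b = e * (br ω' (d.plug (leadMon g)) * b') →
          TrivialMod Ctx.plug 𝒢 ((Ctx.nest a ω c b).plug (leadMon f))
            (mapDomain (Ctx.nest a ω c b).plug (monicize f) -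
              mapDomain (Ctx.nest (a * e) ω' d b').plug (monicize g)) := by
        intro f g hf hg hf0 hg0 a e b b' ω ω' c d he1 he
        cases e with
        | nil => exact absurd rfl he1
        | consVar z w => exact absurd he (by simp [br])
        | consBr ω'' u w =>
          obtain ⟨rfl, rfl, hw⟩ := consBr.inj he
          have hw' : b = w * (br ω' (d.plug (leadMon g)) * b') := hw
          subst hw'
          have := trivialMod_disjoint hmon hf hg hf0 hg0 (Ctx.nest a ω c w)
            (Ctx.nest 1 ω' d b')
          simpa [Ctx.mul, Ctx.plug, mul_assoc, consBr_eq] using this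
      have h' := h
      simp only [Ctx.plug, mul_assoc] at h
      have same : a = a' → TrivialMod Ctx.plug 𝒢 ((Ctx.nest a ω c b).plug (leadMon f))
            (mapDomain (Ctx.nest a ω c b).plug (monicize f) -
              mapDomain (Ctx.nest a' ω' d b').plug (monicize g)) := by
        rintro rfl
        obtain ⟨rfl, h2, h3⟩ := consBr.inj (mul_left_cancel' h)
        have h3' : b = b' := h3
        subst h3'
        have := (ih d h2).plug hmon (Ctx.nest a ω (Ctx.flat 1 1) b)
        rw [mapDomain_sub', ← mapDomain_plug_comp, ← mapDomain_plug_comp, ← Ctx.plug_comp] at this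
        have e : ∀ c : Ctx Ω Z, (Ctx.nest a ω (Ctx.flat 1 1) b).comp c = Ctx.nest a ω c b := by
          intro c
          cases c <;> simp [Ctx.comp, Ctx.mul]
        rwa [e, e] at this
      rcases mul_eq_mul h with ⟨e, he, h1⟩ | ⟨e, he, h1⟩
      · by_cases he1 : e = 1
        · exact same (by rw [he, he1, mul_one])
        · subst he
          exact symm h' (key hg hf hg0 hf0 a' e b' b ω' ω d c he1 h1)
      · by_cases he1 : e = 1
        · exact same (by rw [he, he1, mul_one])
        · subst he
          exact key hf hg hf0 hg0 a e b b' ω ω' c d he1 h1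

/-- The composition-diamond lemma: an element of the ideal generated by `𝒢` whose monomials are
all `< p` is trivial modulo `(𝒢, p)`. -/
theorem trivialMod_of_mem_span (hmon : IsMonomialOrder Ω Z)
    (hpair : ∀ f ∈ 𝒢, ∀ g ∈ 𝒢, f ≠ 0 → g ≠ 0 → ∀ c d : Ctx Ω Z,
      c.plug (leadMon f) = d.plug (leadMon g) →
      TrivialMod Ctx.plug 𝒢 (c.plug (leadMon f))
        (mapDomain c.plug (monicize f) - mapDomain d.plug (monicize g)))
    {p : OpWord Ω Z} {h : MonoidAlgebra k (OpWord Ω Z)}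
    (hspan : h ∈ Submodule.span k {h | ∃ c : Ctx Ω Z, ∃ s ∈ 𝒢, h = mapDomain c.plug s})
    (hp : h ∈ supported k k (Set.Iio p)) : TrivialMod Ctx.plug 𝒢 p h := by
  let V : OpWord Ω Z → Submodule k (MonoidAlgebra k (OpWord Ω Z)) := fun W =>
    Submodule.span k {h | ∃ c : Ctx Ω Z, ∃ s ∈ 𝒢, s ≠ 0 ∧ c.plug (leadMon s) ≤ W ∧
      h = mapDomain c.plug s}
  have hV : Monotone V := fun W W' hW => Submodule.span_mono
    fun h ⟨c, s, hs, hs0, hle, e⟩ => ⟨c, s, hs, hs0, hle.trans hW, e⟩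
  -- A finite sum has a largest leading word, which still satisfies `P`. Zero elements of `𝒢` are
  -- discarded, since their leading monomial is only a convention.
  have bound : ∀ (P : OpWord Ω Z → Prop) (h : MonoidAlgebra k (OpWord Ω Z)),
      h ∈ Submodule.span k {h | ∃ c : Ctx Ω Z, ∃ s ∈ 𝒢, P (c.plug (leadMon s)) ∧
        h = mapDomain c.plug s} → h = 0 ∨ ∃ W, P W ∧ h ∈ V W := by
    intro P h hh
    induction hh using Submodule.span_induction with
    | mem h hh =>
      obtain ⟨c, s, hs, hP, rfl⟩ := hh
      by_cases hs0 : s = 0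
      · exact Or.inl (by rw [hs0, mapDomain_zero])
      · exact Or.inr ⟨_, hP, Submodule.subset_span ⟨c, s, hs, hs0, le_rfl, rfl⟩⟩
    | zero => exact Or.inl rfl
    | add x y _ _ hx hy =>
      rcases hx with rfl | ⟨W, hW, hx⟩
      · simpa using hy
      rcases hy with rfl | ⟨W', hW', hy⟩
      · exact Or.inr ⟨W, hW, by simpa using hx⟩
      rcases le_total W W' with hle | hle
      · exact Or.inr ⟨W', hW', Submodule.add_mem _ (hV hle hx) hy⟩
      · exact Or.inr ⟨W, hW, Submodule.add_mem _ hx (hV hle hy)⟩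
    | smul c x _ hx =>
      rcases hx with rfl | ⟨W, hW, hx⟩
      · exact Or.inl (smul_zero _)
      · exact Or.inr ⟨W, hW, Submodule.smul_mem _ _ hx⟩
  -- Well-founded induction on the bound `W` for the leading words of a representation: as long as
  -- `W ≥ p`, the bound can be lowered.
  have main : ∀ W, ∀ h ∈ V W, h ∈ supported k k (Set.Iio p) → TrivialMod Ctx.plug 𝒢 p h := by
    intro W
    induction W using hmon.wf.induction with
    | _ W ih =>
    intro h hh hp
    rcases lt_or_ge W p with hW | hW
    · refine Submodule.span_mono ?_ hh
      rintro _ ⟨c, s, hs, _, hle, rfl⟩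
      exact ⟨c, s, hs, lt_of_le_of_lt hle hW, rfl⟩
    have hT : TrivialMod Ctx.plug 𝒢 W h := by
      by_cases hex : ∃ c : Ctx Ω Z, ∃ s ∈ 𝒢, s ≠ 0 ∧ c.plug (leadMon s) = W
      · obtain ⟨c, s, hs, hs0, rfl⟩ := hex
        -- All summands led by `W` are traded, modulo `W`, for multiples of a single one of them.
        have : ∃ a : k, TrivialMod Ctx.plug 𝒢 (c.plug (leadMon s))
            (h - a • mapDomain c.plug (monicize s)) := by
          clear hp
          induction hh using Submodule.span_induction with
          | mem h hh =>
            obtain ⟨d, t, ht, ht0, hle, rfl⟩ := hh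
            rcases hle.lt_or_eq with hlt | heq
            · exact ⟨0, by rw [zero_smul, sub_zero]; exact TrivialMod.of_lt _ ht hlt⟩
            · refine ⟨leadCoeff t, ?_⟩
              have := (hpair t ht s hs ht0 hs0 d c heq).smul (leadCoeff t)
              rwa [smul_sub, ← mapDomain_smul', leadCoeff_smul_monicize ht0, heq] at this
          | zero => exact ⟨0, by rw [zero_smul, sub_zero]; exact TrivialMod.zero⟩
          | add x y _ _ hx hy =>
            obtain ⟨a, ha⟩ := hx
            obtain ⟨b, hb⟩ := hy
            refine ⟨a + b, ?_⟩
            rw [add_smul, add_sub_add_comm]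
            exact ha.add hb
          | smul r x _ hx =>
            obtain ⟨a, ha⟩ := hx
            refine ⟨r * a, ?_⟩
            rw [mul_smul, ← smul_sub]
            exact ha.smul r
        obtain ⟨a, ha⟩ := this
        have h1 := mem_supported'.1 (ha.mem_supported hmon.strictMono_plug) _ (lt_irrefl _)
        have h2 := mem_supported'.1 hp (c.plug (leadMon s)) (not_lt.2 hW)
        have h3 :=
          ((monicize_isMonicLead hs0).mapDomain (hmon.strictMono_plug c)).coeff_eq_one
        -- Compare coefficients at `W`: it is `0` in `h`, because `W ≥ p`, and `1` in the monic
        -- summand.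
        have h4 : a = 0 := by
          rw [coeff_sub, coeff_smul, Finsupp.sub_apply, Finsupp.smul_apply, h2, h3] at h1
          simpa using h1
        rwa [h4, zero_smul, sub_zero] at ha
      · push Not at hex
        refine Submodule.span_mono ?_ hh
        rintro _ ⟨c, s, hs, hs0, hle, rfl⟩
        exact ⟨c, s, hs, lt_of_le_of_ne hle (hex c s hs hs0), rfl⟩
    rcases bound (fun w => w < W) h hT with rfl | ⟨W', hW', hh'⟩
    · exact TrivialMod.zero
    · exact ih W' hW' h hh' hp
  rcases bound (fun _ => True) h (by simpa using hspan) with rfl | ⟨W, _, hW⟩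
  · exact TrivialMod.zero
  · exact main W h hW hp

end CompositionDiamond

/-! ### When a value of an OPI can vanish -/

section Vanishing

open MonoidAlgebra OpWord

namespace OpWord

variable {Ω : Type u₁} {X : Type u₂} {Y : Type u₃} {Z : Type u₄}

theorem occ_subst {x : X} {y : Y} {σ : X → OpWord Ω Y} (h : ∀ x', x' ≠ x → occ y (σ x') = 0)
    (m : OpWord Ω X) : occ y (m.subst σ) = occ x m * occ y (σ x) := by
  classical
  induction m with
  | nil => simp
  | consVar x' w ih =>
    rw [subst_consVar, occ_mul, ih, occ_consVar, add_mul]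
    by_cases hx : x' = x
    · rw [if_pos hx, hx, one_mul]
    · rw [if_neg hx, h x' hx, zero_mul]
  | consBr ω u w ihu ih => rw [subst_consBr, occ_consBr, ihu, ih, occ_consBr, add_mul]

theorem occ_subst_eq_zero {y : Y} {σ : X → OpWord Ω Y} (h : ∀ x, occ y (σ x) = 0)
    (m : OpWord Ω X) : occ y (m.subst σ) = 0 := by
  induction m with
  | nil => simp
  | consVar x' w ih => simp [h, ih]
  | consBr ω u w ihu ih => simp [ihu, ih]

theorem occ_rename {f : X → Y} (hf : Function.Injective f) (x : X) (m : OpWord Ω X) :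
    occ (f x) (m.subst fun i => var (f i)) = occ x m := by
  rw [occ_subst (x := x), occ_var, if_pos rfl, mul_one]
  intro x' hx'
  rw [occ_var, if_neg fun h => hx' (hf h)]

theorem occ_rename_of_forall_ne {f : X → Y} {y : Y} (hf : ∀ x, f x ≠ y) (m : OpWord Ω X) :
    occ y (m.subst fun i => var (f i)) = 0 :=
  occ_subst_eq_zero (fun x => by rw [occ_var, if_neg (hf x)]) m

theorem le_occ_rename (f : X → Y) (x : X) (m : OpWord Ω X) :
    occ x m ≤ occ (f x) (m.subst fun i => var (f i)) := by
  classical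
  induction m with
  | nil => simp
  | consVar x' w ih =>
    simp only [subst_consVar, occ_mul, occ_var, occ_consVar]
    refine add_le_add ?_ ih
    split_ifs with h1 h2 <;> simp_all
  | consBr ω u w ihu ih => exact add_le_add ihu ih

/-- Identifying two letters adds up their occurrences; this forces a renaming between linear words
to be injective on the letters that occur. -/
theorem add_le_occ_rename {f : X → Y} {x x' : X} (hx : x ≠ x') (hf : f x = f x')
    (m : OpWord Ω X) : occ x m + occ x' m ≤ occ (f x) (m.subst fun i => var (f i)) := by
  classical
  induction m with
  | nil => simp
  | consVar y w ih =>
    simp only [subst_consVar, occ_mul, occ_var, occ_consVar]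
    have : ((if y = x then 1 else 0) + if y = x' then 1 else 0) ≤
        if f y = f x then 1 else 0 := by
      by_cases h1 : y = x
      · subst h1; simp [hx]
      · by_cases h2 : y = x'
        · subst h2; simp [h1, hf]
        · simp [h1, h2]
    omega
  | consBr ω u w ihu ih =>
    simp only [subst_consBr, occ_consBr]
    omega

/-- Two words of the same shape, the first one linear, differ by a renaming of the letters. -/
theorem exists_rename {τ : X → Y} {m m' : OpWord Ω X}
    (h : m.subst (fun x => var (τ x)) = m'.subst fun x => var (τ x))
    (hm : ∀ x, occ x m ≤ 1) : ∃ π : X → X, (m.subst fun x => var (π x)) = m' := by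
  classical
  induction m generalizing m' with
  | nil =>
    cases m' with
    | nil => exact ⟨id, rfl⟩
    | consVar x w => exact absurd h (by simp [var, ← nil_eq_one])
    | consBr ω u w => exact absurd h (by simp [← nil_eq_one])
  | consVar x w ih =>
    cases m' with
    | nil => exact absurd h (by simp [var, ← nil_eq_one])
    | consBr ω u w => exact absurd h (by simp [var])
    | consVar x' w' =>
      have h2 := (consVar.inj h).2
      obtain ⟨π, rfl⟩ := ih h2 fun y => le_trans (by simp) (hm y)
      -- Redefining `π` at `x` is harmless: by linearity `x` does not occur in the rest of the word.
      refine ⟨Function.update π x x', ?_⟩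
      rw [subst_consVar, Function.update_self, consVar_eq]
      congr 1
      refine subst_congr fun y hy => ?_
      have hxy : y ≠ x := by
        rintro rfl
        have := hm y
        rw [occ_consVar, if_pos rfl] at this
        omega
      rw [Function.update_of_ne hxy]
  | consBr ω u w ihu ih =>
    cases m' with
    | nil => exact absurd h (by simp [← nil_eq_one])
    | consVar x w => exact absurd h (by simp [var])
    | consBr ω' u' w' =>
      obtain ⟨rfl, hu, hw⟩ := consBr.inj h
      obtain ⟨π₁, rfl⟩ := ihu hu fun y => le_trans (by simp) (hm y)
      obtain ⟨π₂, rfl⟩ := ih hw fun y => le_trans (by simp) (hm y)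
      refine ⟨fun x => if occ x u = 0 then π₂ x else π₁ x, ?_⟩
      rw [subst_consBr]
      congr 1
      · exact subst_congr fun y hy => by simp [hy]
      · refine subst_congr fun y hy => ?_
        have := hm y
        rw [occ_consBr] at this
        have h0 : occ y u = 0 := by omega
        simp [h0]

theorem breadth_var_pow (z : Z) (j : ℕ) : breadth ((var z : OpWord Ω Z) ^ j) = j := by
  induction j with
  | zero => simp
  | succ j ih => rw [pow_succ, breadth_mul, ih]; rfl

/-- Substituting brackets of different powers of a letter for the letters is injective. -/
theorem code_injective {ω : Ω} {z : Z} {n : X → ℕ} {S : Set X} (hn : Set.InjOn n S)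
    {m m' : OpWord Ω X} (hm : ∀ x, occ x m ≠ 0 → x ∈ S) (hm' : ∀ x, occ x m' ≠ 0 → x ∈ S)
    (h : m.subst (fun x => br ω (var z ^ (n x + 1))) =
      m'.subst fun x => br ω (var z ^ (n x + 1))) : m = m' := by
  classical
  -- The exponent is positive, so the content of a coding bracket starts with a plain letter,
  -- whereas a substituted word is empty or starts with a bracket. Coding brackets are thus told
  -- apart from those of the word itself.
  have aux : ∀ (j : ℕ) (u : OpWord Ω X),
      (var z : OpWord Ω Z) ^ (j + 1) ≠ u.subst fun x => br ω (var z ^ (n x + 1)) := by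
    intro j u hu
    rw [pow_succ'] at hu
    cases u with
    | nil => exact absurd hu (by simp [var, ← nil_eq_one])
    | consVar x w => exact absurd hu (by simp [var, br])
    | consBr ω' u w => exact absurd hu (by simp [var])
  induction m generalizing m' with
  | nil =>
    cases m' with
    | nil => rfl
    | consVar x w => exact absurd h (by simp [br, ← nil_eq_one])
    | consBr ω u w => exact absurd h (by simp [← nil_eq_one])
  | consVar x w ih =>
    cases m' with
    | nil => exact absurd h (by simp [br, ← nil_eq_one])
    | consVar x' w' =>
      obtain ⟨-, h1, h2⟩ := consBr.inj h
      have h3 := congrArg breadth h1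
      rw [breadth_var_pow, breadth_var_pow] at h3
      have h4 : x = x' := hn (hm x (by simp)) (hm' x' (by simp)) (by omega)
      rw [h4, ih (fun y hy => hm y (by simp [hy])) (fun y hy => hm' y (by simp [hy])) h2]
    | consBr ω' u w' => exact absurd (consBr.inj h).2.1 (aux _ _)
  | consBr ω' u w ihu ih =>
    cases m' with
    | nil => exact absurd h (by simp [← nil_eq_one])
    | consVar x' w' => exact absurd (consBr.inj h).2.1.symm (aux _ _)
    | consBr ω'' u' w' =>
      obtain ⟨rfl, h1, h2⟩ := consBr.inj h
      rw [ihu (fun y hy => hm y (by simp [hy])) (fun y hy => hm' y (by simp [hy])) h1,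
        ih (fun y hy => hm y (by simp [hy])) (fun y hy => hm' y (by simp [hy])) h2]

/-- `A` and `B` are obtained from the same linear word, `A` by substituting letters. -/
def LetterTag (A B : OpWord Ω Z) : Prop :=
  ∃ W : OpWord Ω ℕ, (∀ n, occ n W ≤ 1) ∧ ∃ (τ : ℕ → Z) (ρ : ℕ → OpWord Ω Z),
    (W.subst fun n => var (τ n)) = A ∧ W.subst ρ = B

theorem LetterTag.var (z : Z) (B : OpWord Ω Z) : LetterTag (var z) B :=
  ⟨OpWord.var 0, fun n => by rw [occ_var]; split_ifs <;> simp, fun _ => z, fun _ => B,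
    by simp, by simp⟩

theorem LetterTag.br (ω : Ω) {A B : OpWord Ω Z} (h : LetterTag A B) :
    LetterTag (br ω A) (br ω B) := by
  obtain ⟨W, hW, τ, ρ, rfl, rfl⟩ := h
  exact ⟨OpWord.br ω W, hW, τ, ρ, rfl, rfl⟩

theorem LetterTag.one [Nonempty Z] : LetterTag (1 : OpWord Ω Z) 1 :=
  ⟨1, fun _ => by simp, fun _ => Classical.arbitrary Z, fun _ => 1, rfl, rfl⟩

theorem LetterTag.mul {A B A' B' : OpWord Ω Z} (h : LetterTag A B) (h' : LetterTag A' B') :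
    LetterTag (A * A') (B * B') := by
  obtain ⟨W, hW, τ, ρ, rfl, rfl⟩ := h
  obtain ⟨W', hW', τ', ρ', rfl, rfl⟩ := h'
  have i1 : Function.Injective fun i : ℕ => 2 * i := fun a b h => by dsimp at h; omega
  have i2 : Function.Injective fun i : ℕ => 2 * i + 1 := fun a b h => by dsimp at h; omega
  -- Even indices for the left factor and odd ones for the right keep the product linear.
  refine ⟨(W.subst fun i => OpWord.var (2 * i)) * W'.subst fun i => OpWord.var (2 * i + 1),
    fun n => ?_, fun n => if n % 2 = 0 then τ (n / 2) else τ' (n / 2),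
    fun n => if n % 2 = 0 then ρ (n / 2) else ρ' (n / 2), ?_, ?_⟩
  · rw [occ_mul]
    obtain ⟨i, rfl | rfl⟩ := Nat.even_or_odd' n
    · rw [occ_rename (f := fun i : ℕ => 2 * i) i1, occ_rename_of_forall_ne (fun j => by omega)]
      exact hW i
    · rw [occ_rename (f := fun i : ℕ => 2 * i + 1) i2,
        occ_rename_of_forall_ne (fun j => by omega), zero_add]
      exact hW' i
  · have e : ∀ i, (2 * i + 1) / 2 = i := fun i => by omega
    simp [subst_subst, Nat.add_mod, e]
  · have e : ∀ i, (2 * i + 1) / 2 = i := fun i => by omega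
    simp [subst_subst, Nat.add_mod, e]

theorem LetterTag.refl [Nonempty Z] (A : OpWord Ω Z) : LetterTag A A := by
  induction A with
  | nil => exact LetterTag.one
  | consVar z w ih =>
    rw [consVar_eq]
    exact (LetterTag.var z _).mul ih
  | consBr ω u w ihu ih => exact (ihu.br ω).mul ih

/-- Without brackets, every letter can be specialized to `1` and nothing is left; a bracket would
survive. -/
theorem LetterTag.of_brFree [Nonempty Z] {A : OpWord Ω Z} (hA : BrFree A) : LetterTag A 1 := by
  induction A with
  | nil => exact LetterTag.one
  | consVar z w ih =>
    rw [consVar_eq]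
    simpa using (LetterTag.var z 1).mul (ih hA)
  | consBr ω u w ihu ih => exact hA.elim

end OpWord

variable {k : Type u₁} [Field k] {Ω : Type u₂} {X : Type u₃} {Z : Type u₄}

theorem evalOPI_evalOPI {Y : Type*} (σ : X → OpWord Ω Y) (τ : Y → OpWord Ω Z)
    (φ : MonoidAlgebra k (OpWord Ω X)) :
    evalOPI τ (evalOPI σ φ) = evalOPI (fun x => (σ x).subst τ) φ := by
  rw [evalOPI, evalOPI, mapDomain_mapDomain]
  exact mapDomain_congr' fun m _ => subst_subst σ τ m

theorem evalOPI_congr {σ τ : X → OpWord Ω Z} {φ : MonoidAlgebra k (OpWord Ω X)}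
    (h : ∀ m ∈ φ.coeff.support, ∀ x, occ x m ≠ 0 → σ x = τ x) : evalOPI σ φ = evalOPI τ φ :=
  mapDomain_congr' fun m hm => subst_congr (h m hm)

variable [LinearOrder (OpWord Ω Z)]

/-- A multilinear element, whose values at all words have their leading monomial at the same
place `M₀`, vanishes as soon as its value at some letters does. -/
theorem eq_zero_of_evalOPI_var_eq_zero [Nonempty Ω] (hmon : IsMonomialOrder Ω Z)
    [Countable X] [Nonempty Z] {φ : MonoidAlgebra k (OpWord Ω X)} {c : X → ℕ} (hc : ∀ x, c x ≤ 1)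
    (hφ : ∀ m ∈ φ.coeff.support, ∀ x, occ x m = c x) {M₀ : OpWord Ω X}
    (hM₀ : ∀ x, occ x M₀ = c x)
    (hlead : ∀ w : X → OpWord Ω Z, evalOPI w φ = 0 ∨ leadMon (evalOPI w φ) = M₀.subst w)
    {τ : X → Z} (h0 : evalOPI (fun x => (var (τ x) : OpWord Ω Z)) φ = 0) : φ = 0 := by
  classical
  by_contra hne
  obtain ⟨ω⟩ := ‹Nonempty Ω›
  obtain ⟨z⟩ := ‹Nonempty Z›
  obtain ⟨n, hn⟩ := exists_injective_nat X
  let S : Set X := {x | c x ≠ 0}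
  let 𝒮 : Set (OpWord Ω X) := {m | ∀ x, occ x m = c x}
  let code : (X → ℕ) → X → OpWord Ω Z := fun n x => br ω (var z ^ (n x + 1))
  have hinj : ∀ n : X → ℕ, Set.InjOn n S → Set.InjOn (fun m => m.subst (code n)) 𝒮 := by
    intro n hn m hm m' hm' h
    exact code_injective hn (fun x hx => by rwa [hm x] at hx) (fun x hx => by rwa [hm' x] at hx) h
  have hcoeff : ∀ n : X → ℕ, Set.InjOn n S → ∀ m ∈ 𝒮,
      (evalOPI (code n) φ).coeff (m.subst (code n)) = φ.coeff m := by
    intro n hn m hm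
    exact Finsupp.mapDomain_apply' 𝒮 φ.coeff (fun m hm => hφ m hm) (hinj n hn) hm
  have hlead' : ∀ n : X → ℕ, Set.InjOn n S →
      evalOPI (code n) φ ≠ 0 ∧ leadMon (evalOPI (code n) φ) = M₀.subst (code n) := by
    intro n hn
    have h1 : evalOPI (code n) φ ≠ 0 := by
      intro h
      apply hne
      rw [← coeff_eq_zero]
      ext m
      by_cases hm : m ∈ 𝒮
      · rw [← hcoeff n hn m hm, h]
        rfl
      · exact Finsupp.notMem_support_iff.1 fun h => hm (hφ m h)
    exact ⟨h1, (hlead _).resolve_left h1⟩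
  -- Codes with distinct exponents separate the monomials of `φ`, so the coefficient at the leading
  -- place can be read off from a nonzero value.
  have hM₀φ : φ.coeff M₀ ≠ 0 := by
    obtain ⟨h1, h2⟩ := hlead' n hn.injOn
    rw [← hcoeff n hn.injOn M₀ hM₀, ← h2]
    exact coeff_leadMon_ne_zero h1
  -- Otherwise the coefficient of `M₀` would survive in the value at `τ`, which is zero.
  obtain ⟨M₁, hM₁, hne₁, heq⟩ : ∃ M₁ ∈ φ.coeff.support, M₁ ≠ M₀ ∧
      (M₀.subst fun x => (var (τ x) : OpWord Ω Z)) = M₁.subst fun x => var (τ x) := by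
    by_contra hcon
    push Not at hcon
    have h1 := coeff_mapDomain_eq
      (f := fun m : OpWord Ω X => m.subst fun x => (var (τ x) : OpWord Ω Z)) (x := φ) (m₀ := M₀)
      fun m hm h => by_contra fun hne => hcon m hm hne h.symm
    rw [evalOPI] at h0
    rw [h0] at h1
    exact hM₀φ h1.symm
  obtain ⟨π, hπ⟩ := exists_rename heq fun x => (hM₀ x).trans_le (hc x)
  have hocc₁ := hφ M₁ hM₁
  have hmaps : Set.MapsTo π S S := by
    intro x hx
    have := le_occ_rename π x M₀
    rw [hπ, hM₀, hocc₁] at this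
    have hx' : c x ≠ 0 := hx
    exact fun h => hx' (by omega)
  have hinjπ : Set.InjOn π S := by
    intro x hx y hy hxy
    by_contra hne
    have := add_le_occ_rename hne hxy M₀
    rw [hπ, hM₀, hM₀, hocc₁] at this
    have hx' : c x ≠ 0 := hx
    have hy' : c y ≠ 0 := hy
    have := hc (π x)
    omega
  have hiter : ∀ i, Set.InjOn (n ∘ π^[i]) S := fun i =>
    hn.comp_injOn (hinjπ.iterate hmaps i)
  -- Since `M₁` is `M₀` renamed by `π`, its value at the `i`-th code is the value of `M₀` at the
  -- next one. It is smaller because `M₀` leads at every code.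
  have hdesc : ∀ i, M₀.subst (code (n ∘ π^[i + 1])) < M₀.subst (code (n ∘ π^[i])) := by
    intro i
    have e : M₀.subst (code (n ∘ π^[i + 1])) = M₁.subst (code (n ∘ π^[i])) := by
      rw [← hπ, subst_subst]
      simp [code]
    rw [e]
    refine lt_of_le_of_ne ?_ fun h => hne₁ (hinj _ (hiter i) hocc₁ hM₀ h)
    rw [← (hlead' _ (hiter i)).2]
    refine le_leadMon ?_
    rw [Finsupp.mem_support_iff, hcoeff _ (hiter i) M₁ hocc₁]
    exact Finsupp.mem_support_iff.1 hM₁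
  obtain ⟨_, ⟨i, rfl⟩, hi⟩ := hmon.wf.has_min
    (Set.range fun i => M₀.subst (code (n ∘ π^[i]))) (Set.range_nonempty _)
  exact hi _ ⟨i + 1, rfl⟩ (hdesc i)

/-- Both values specialize one polarized element, in which every argument is a linear word in its
own fresh variables. The value at `σ'` puts letters for them, so its vanishing kills the polarized
element and with it the value at `σ`. -/
theorem evalOPI_eq_zero_of_letterTag [Nonempty Ω] [Nonempty Z] [LinearOrder (OpWord Ω X)]
    (hmon : IsMonomialOrder Ω Z)
    {φ : MonoidAlgebra k (OpWord Ω X)} (hφ : IsOPI φ)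
    (hlead : ∀ σ : X → OpWord Ω Z,
      evalOPI σ φ = 0 ∨ leadMon (evalOPI σ φ) = (leadMon φ).subst σ)
    {σ σ' : X → OpWord Ω Z} (hσ : ∀ x, LetterTag (σ' x) (σ x)) (h0 : evalOPI σ' φ = 0) :
    evalOPI σ φ = 0 := by
  classical
  by_cases hφ0 : φ = 0
  · rw [hφ0, evalOPI, mapDomain_zero]
  obtain ⟨s, -, hs⟩ := hφ
  choose W hW τ ρ h1 h2 using hσ
  -- The first index keeps the fresh variables of different arguments apart. It ranges over the
  -- finite set `s`, not over `X`, so that the variables are countable.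
  let V : X → OpWord Ω (s × ℕ) := fun x =>
    if h : x ∈ s then (W x).subst fun n => var (⟨x, h⟩, n) else 1
  have hV : ∀ {Y : Type u₄} (μ : X → ℕ → OpWord Ω Y), ∀ x ∈ s,
      ((V x).subst fun t => μ t.1 t.2) = (W x).subst (μ x) := by
    intro Y μ x hx
    simp only [V, dif_pos hx, subst_subst, subst_var]
  have hmem : ∀ m ∈ φ.coeff.support, ∀ x, occ x m ≠ 0 → x ∈ s := fun m hm x hx => by
    by_contra h
    exact hx ((hs m hm).2 x h)
  have hocc : ∀ m ∈ φ.coeff.support, ∀ t : s × ℕ, occ t (m.subst V) = occ t.2 (W t.1) := by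
    rintro m hm ⟨⟨x, hx⟩, n⟩
    rw [occ_subst (x := x), (hs m hm).1 x hx, one_mul]
    · simp only [V, dif_pos hx]
      exact occ_rename (f := fun n => ((⟨x, hx⟩ : s), n)) (fun a b h => (Prod.mk.inj h).2) n _
    · intro y hy
      by_cases hys : y ∈ s
      · simp only [V, dif_pos hys]
        refine occ_rename_of_forall_ne (fun j h => hy ?_) _
        exact congrArg (fun t : s × ℕ => (t.1 : X)) h
      · simp [V, hys]
  have key : evalOPI V φ = 0 := by
    refine eq_zero_of_evalOPI_var_eq_zero hmon (c := fun t => occ t.2 (W t.1))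
      (M₀ := (leadMon φ).subst V) (τ := fun t => τ t.1 t.2) (fun t => hW _ _) ?_
      (hocc _ (leadMon_mem_support hφ0)) ?_ ?_
    · intro m hm
      obtain ⟨m', hm', rfl⟩ := Finset.mem_image.1 (Finsupp.mapDomain_support hm)
      exact hocc m' hm'
    · intro w
      rw [evalOPI_evalOPI, subst_subst]
      exact hlead _
    · rw [evalOPI_evalOPI, ← h0]
      refine evalOPI_congr fun m hm x hx => ?_
      rw [← h1 x]
      exact hV (fun x n => var (τ x n)) x (hmem m hm x hx)
  have : evalOPI σ φ = evalOPI (fun t : s × ℕ => ρ t.1 t.2) (evalOPI V φ) := by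
    rw [evalOPI_evalOPI]
    refine evalOPI_congr fun m hm x hx => ?_
    rw [← h2 x]
    exact (hV ρ x (hmem m hm x hx)).symm
  rw [this, key, evalOPI, mapDomain_zero]

end Vanishing

/-! ### Bracket-free subwords of substituted words -/

namespace OpWord

variable {Ω : Type u₁} {X : Type u₂} {Z : Type u₃}

theorem eq_one_of_br_eq_mul {ω : Ω} {u a e : OpWord Ω Z} (h : br ω u = a * e) (he : BrFree e) :
    e = 1 := by
  cases a with
  | nil =>
    rw [nil_eq_one, one_mul] at h
    rw [← h] at he
    exact he.elim
  | consVar z w => exact absurd h (by simp [br])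
  | consBr ω' u' w => exact (mul_eq_one' (consBr.inj h).2.2.symm).2

theorem eq_one_of_consBr_eq_mul {ω : Ω} {u w e a : OpWord Ω Z} (h : consBr ω u w = e * a)
    (he : BrFree e) : e = 1 := by
  cases e with
  | nil => rfl
  | consVar z w => exact absurd h (by simp)
  | consBr ω' u' w => exact he.elim

/-- An occurrence of a word in a product lies in one of the factors or meets both. -/
theorem plug_eq_mul {c : Ctx Ω Z} {w A B : OpWord Ω Z} (h : c.plug w = A * B) :
    (∃ d : Ctx Ω Z, A = d.plug w) ∨ (∃ d : Ctx Ω Z, B = d.plug w) ∨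
      ∃ e f, w = e * f ∧ e ≠ 1 ∧ f ≠ 1 ∧ (∃ a, A = a * e) ∧ ∃ b, B = f * b := by
  cases c with
  | flat a b =>
    simp only [Ctx.plug, mul_assoc] at h
    rcases mul_eq_mul h with ⟨e, -, h1⟩ | ⟨e, rfl, h1⟩
    · exact Or.inr (Or.inl ⟨.flat e b, by rw [h1, Ctx.plug, mul_assoc]⟩)
    · rcases mul_eq_mul h1 with ⟨e', rfl, rfl⟩ | ⟨e', rfl, -⟩
      · by_cases he' : e' = 1
        · exact Or.inl ⟨.flat a 1, by simp [Ctx.plug, he']⟩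
        by_cases he : e = 1
        · exact Or.inr (Or.inl ⟨.flat 1 b, by simp [Ctx.plug, he]⟩)
        exact Or.inr (Or.inr ⟨e, e', rfl, he, he', ⟨a, rfl⟩, b, rfl⟩)
      · exact Or.inl ⟨.flat a e', by rw [Ctx.plug, mul_assoc]⟩
  | nest a ω d b =>
    simp only [Ctx.plug, mul_assoc] at h
    rcases mul_eq_mul h with ⟨e, -, h1⟩ | ⟨e, rfl, h1⟩
    · exact Or.inr (Or.inl ⟨.nest e ω d b, by rw [h1, Ctx.plug, mul_assoc]⟩)
    · cases e with
      | nil => exact Or.inr (Or.inl ⟨.nest 1 ω d b, by rw [Ctx.plug, one_mul]; exact h1.symm⟩)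
      | consVar z v => exact absurd h1 (by simp [br])
      | consBr ω' u v =>
        obtain ⟨rfl, rfl, -⟩ := consBr.inj h1
        exact Or.inl ⟨.nest a ω d v, by rw [Ctx.plug, mul_assoc, consBr_eq]⟩

section NoAdjacent

/-- No two letters from `X` are adjacent in the word. -/
def NoAdjacent (m : OpWord Ω X) : Prop :=
  ∀ (c : Ctx Ω X) (x y : X), m ≠ c.plug (var x * var y)

theorem NoAdjacent.of_mul {a m b : OpWord Ω X} (h : NoAdjacent (a * m * b)) : NoAdjacent m :=
  fun c x y e => h (.mul a c b) x y (by rw [Ctx.plug_mul, e])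

theorem NoAdjacent.of_consVar {x : X} {m : OpWord Ω X} (h : NoAdjacent (consVar x m)) :
    NoAdjacent m :=
  NoAdjacent.of_mul (a := var x) (b := 1) (by rwa [mul_one])

theorem NoAdjacent.of_consBr {ω : Ω} {u m : OpWord Ω X} (h : NoAdjacent (consBr ω u m)) :
    NoAdjacent u ∧ NoAdjacent m :=
  ⟨fun c x y e => h (.nest 1 ω c m) x y (by rw [Ctx.plug, one_mul, e, consBr_eq]),
    NoAdjacent.of_mul (a := br ω u) (b := 1) (by rwa [mul_one])⟩

/-- What follows a variable is the end of the word or a bracket, so a bracket-free word cannot reach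
beyond the value of that variable. -/
theorem NoAdjacent.eq_one_of_subst_eq_mul {x : X} {m : OpWord Ω X} (h : NoAdjacent (consVar x m))
    {σ : X → OpWord Ω Z} {e b : OpWord Ω Z} (he : BrFree e) (hm : m.subst σ = e * b) : e = 1 := by
  cases m with
  | nil => exact (mul_eq_one' hm.symm).1
  | consVar y m => exact absurd rfl (h (.flat 1 m) x y)
  | consBr ω u m => exact eq_one_of_consBr_eq_mul hm he

/-- A bracket-free occurrence neither contains a bracket of `m` nor straddles the values of two
variables, since these are separated by brackets. The only places left are inside a single `σ x`. -/
theorem NoAdjacent.exists_plug {m : OpWord Ω X} (hm : NoAdjacent m) {σ : X → OpWord Ω Z}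
    {w : OpWord Ω Z} (hw : BrFree w) (hw1 : w ≠ 1) {c : Ctx Ω Z} (h : m.subst σ = c.plug w) :
    ∃ x, occ x m ≠ 0 ∧ ∃ d : Ctx Ω Z, σ x = d.plug w := by
  classical
  induction m generalizing c with
  | nil =>
    exfalso
    cases c with
    | flat a b => exact hw1 (mul_eq_one' (mul_eq_one' h.symm).1).2
    | nest a ω c b =>
      exact absurd (mul_eq_one' (mul_eq_one' h.symm).1).2 (by simp [br, ← nil_eq_one])
  | consVar x m ih =>
    rcases plug_eq_mul h.symm with ⟨d, hd⟩ | ⟨d, hd⟩ | ⟨e, f, rfl, he, hf, -, b, hb⟩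
    · exact ⟨x, by simp, d, hd⟩
    · obtain ⟨y, hy, hd⟩ := ih hm.of_consVar hd
      exact ⟨y, by simp [hy], hd⟩
    · exact absurd (hm.eq_one_of_subst_eq_mul (brFree_mul.1 hw).2 hb) hf
  | consBr ω u m ihu ih =>
    rw [subst_consBr, consBr_eq] at h
    rcases plug_eq_mul h.symm with ⟨d, hd⟩ | ⟨d, hd⟩ | ⟨e, f, rfl, he, hf, ⟨a, ha⟩, -⟩
    · cases d with
      | flat a b =>
        exfalso
        rw [Ctx.plug] at hd
        cases b with
        | nil =>
          rw [nil_eq_one, mul_one] at hd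
          exact hw1 (eq_one_of_br_eq_mul hd hw)
        | consVar z b =>
          have := congrArg breadth hd
          have h2 : breadth w ≠ 0 := fun h => hw1 (breadth_eq_zero.1 h)
          simp only [breadth_mul, breadth, br] at this
          omega
        | consBr ω' v b =>
          have := congrArg breadth hd
          have h2 : breadth w ≠ 0 := fun h => hw1 (breadth_eq_zero.1 h)
          simp only [breadth_mul, breadth, br] at this
          omega
      | nest a ω' d b =>
        rw [Ctx.plug, mul_assoc] at hd
        cases a with
        | nil =>
          obtain ⟨y, hy, hd⟩ := ihu hm.of_consBr.1 (consBr.inj hd).2.1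
          exact ⟨y, by simp [hy], hd⟩
        | consVar z a => exact absurd hd (by simp [br])
        | consBr ω'' v a =>
          have := mul_eq_one' (mul_eq_one' (consBr.inj hd).2.2.symm).2
          exact absurd this.1 (by simp [br, ← nil_eq_one])
    · obtain ⟨y, hy, hd⟩ := ih hm.of_consBr.2 hd
      exact ⟨y, by simp [hy], hd⟩
    · exact absurd (eq_one_of_br_eq_mul ha (brFree_mul.1 hw).1) he

theorem NoAdjacent.exists_eq_mul_var {m : OpWord Ω X} (hm : NoAdjacent m)
    {σ : X → OpWord Ω Z} {v e : OpWord Ω Z} (he : BrFree e) (he1 : e ≠ 1)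
    (h : m.subst σ = v * e) : ∃ ψ x, m = ψ * var x := by
  induction m generalizing v with
  | nil => exact absurd (mul_eq_one' h.symm).2 he1
  | consVar x m ih =>
    cases hm' : m with
    | nil => exact ⟨1, x, rfl⟩
    | consVar y m' => exact absurd (by rw [hm']; rfl) (hm (.flat 1 m') x y)
    | consBr ω u m' =>
      rcases mul_eq_mul h with ⟨e', -, h1⟩ | ⟨e', -, h1⟩
      · rw [h1, hm', brFree_mul, subst_consBr] at he
        exact he.2.elim
      · obtain ⟨ψ, y, hψ⟩ := ih hm.of_consVar h1
        exact ⟨var x * ψ, y, by rw [← hm', hψ, consVar_eq, mul_assoc]⟩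
  | consBr ω u m _ ih =>
    cases v with
    | nil => exact absurd (eq_one_of_consBr_eq_mul (a := 1) (by rw [mul_one]; exact h) he) he1
    | consVar z v => exact absurd h (by simp)
    | consBr ω' u' v =>
      obtain ⟨ψ, y, rfl⟩ := ih hm.of_consBr.2 (consBr.inj h).2.2
      exact ⟨br ω u * ψ, y, by rw [consBr_eq, mul_assoc]⟩

theorem exists_eq_var_mul {m : OpWord Ω X} {σ : X → OpWord Ω Z} {v e : OpWord Ω Z}
    (he : BrFree e) (he1 : e ≠ 1) (h : m.subst σ = e * v) : ∃ ψ x, m = var x * ψ := by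
  cases m with
  | nil => exact absurd (mul_eq_one' h.symm).1 he1
  | consVar x m => exact ⟨m, x, rfl⟩
  | consBr ω u m => exact absurd (eq_one_of_consBr_eq_mul h he) he1

end NoAdjacent

theorem BrFree.of_subst {m : OpWord Ω X} {σ : X → OpWord Ω Z} (h : BrFree (m.subst σ)) :
    BrFree m := by
  induction m with
  | nil => trivial
  | consVar x m ih => exact ih (brFree_mul.1 h).2
  | consBr ω u m _ _ => exact h.elim

theorem BrFree.nonempty {m : OpWord Ω X} (h : BrFree m) (h1 : m ≠ 1) : Nonempty X := by
  cases m with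
  | nil => exact absurd rfl h1
  | consVar x m => exact ⟨x⟩
  | consBr ω u m => exact h.elim

theorem BrFree.eq_var {m : OpWord Ω X} (h : BrFree m) {x : X} (hx : occ x m = 1)
    (hy : ∀ y, y ≠ x → occ y m = 0) : m = var x := by
  classical
  cases m with
  | nil => simp at hx
  | consBr ω u m => exact h.elim
  | consVar y m =>
    have hyx : y = x := by
      by_contra hne
      simpa using hy y hne
    subst hyx
    cases m with
    | nil => rfl
    | consBr ω u m => exact h.elim
    | consVar z m =>
      exfalso
      by_cases hz : z = y
      · simp [hz] at hx
      · simpa using hy z hz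

/-- The number of letters and brackets of a word. -/
def size : OpWord Ω X → ℕ
  | nil => 0
  | consVar _ w => size w + 1
  | consBr _ u w => size u + size w + 1

@[simp] theorem size_mul (a b : OpWord Ω X) : size (a * b) = size a + size b := by
  induction a with
  | nil => rw [nil_eq_one, one_mul]; exact (zero_add _).symm
  | consVar x w ih => rw [consVar_mul, size, size, ih]; omega
  | consBr ω u w _ ih => rw [consBr_mul, size, size, ih]; omega

theorem size_plug (c : Ctx Ω X) (t : OpWord Ω X) : size (c.plug t) = size (c.plug 1) + size t := by
  have h1 : size (1 : OpWord Ω X) = 0 := rfl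
  have hb : ∀ (ω : Ω) (u : OpWord Ω X), size (br ω u) = size u + 1 := fun ω u => rfl
  induction c with
  | flat a b => simp only [Ctx.plug, size_mul, h1]; omega
  | nest a ω c b ih => simp only [Ctx.plug, size_mul, hb]; omega

/-- Sizes add when a hole is filled, so the context itself has size zero. -/
theorem eq_one_of_plug_eq_self {c : Ctx Ω X} {t : OpWord Ω X} (h : c.plug t = t) :
    c.plug 1 = 1 := by
  have := congrArg size h
  rw [size_plug] at this
  cases hc : c.plug 1 with
  | nil => rfl
  | consVar x w => rw [hc, size] at this; omega
  | consBr ω u w => rw [hc, size] at this; omega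

end OpWord

/-! ### Compositions inside `G`, and inclusions of `G` in values of OPIs -/

section Compositions

open MonoidAlgebra OpWord

variable {k : Type u₁} [Field k] {Ω : Type u₂} {X : Type u₃} {Z : Type u₄}
  [LinearOrder (OpWord Ω Z)]

/-- A Gröbner–Shirshov basis `G` in `k𝓜(Z)`, as a subset of `k𝔐(Z)`, has trivial compositions
for all pairs of words with one hole. -/
theorem IsGSBasis.trivialMod_plug_sub_plug (hmon : IsMonomialOrder Ω Z)
    {G : Set (MonoidAlgebra k (FreeMonoid Z))} (hG : @IsGSBasis k _ Z (restrictOrder Ω Z) G) :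
    (∀ f ∈ inclFree k Ω '' G, f ≠ 0 → BrFree (leadMon f)) ∧
    ∀ f ∈ inclFree k Ω '' G, ∀ g ∈ inclFree k Ω '' G, f ≠ 0 → g ≠ 0 → ∀ c d : Ctx Ω Z,
      c.plug (leadMon f) = d.plug (leadMon g) →
      TrivialMod Ctx.plug (inclFree k Ω '' G) (c.plug (leadMon f))
        (mapDomain c.plug (monicize f) - mapDomain d.plug (monicize g)) := by
  let := restrictOrder Ω Z
  have hmono : StrictMono (ofFree Ω : FreeMonoid Z → OpWord Ω Z) := fun _ _ h => h
  have hne : ∀ {γ : MonoidAlgebra k (FreeMonoid Z)}, inclFree k Ω γ ≠ 0 → γ ≠ 0 := by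
    rintro γ h rfl
    exact h (mapDomain_zero _)
  have hl : ∀ {γ : MonoidAlgebra k (FreeMonoid Z)}, γ ≠ 0 →
      leadMon (inclFree k Ω γ) = ofFree Ω (leadMon γ) := fun h => (mapDomain_monicize hmono h).2
  have hmo : ∀ {γ : MonoidAlgebra k (FreeMonoid Z)}, γ ≠ 0 →
      monicize (inclFree k Ω γ) = inclFree k Ω (monicize γ) :=
    fun h => (mapDomain_monicize hmono h).1
  have hmap : ∀ {p : FreeMonoid Z} {h : MonoidAlgebra k (FreeMonoid Z)},
      TrivialMod (fun (q : FreeMonoid Z × FreeMonoid Z) w => q.1 * w * q.2) G p h →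
      TrivialMod Ctx.plug (inclFree k Ω '' G) (ofFree Ω p) (inclFree k Ω h) := by
    intro p h hh
    refine hh.map fun q s hs hlt => ?_
    by_cases hs0 : s = 0
    · rw [hs0, mapDomain_zero, mapDomain_zero]
      exact TrivialMod.zero
    have e : mapDomain (ofFree Ω) (mapDomain (fun w => q.1 * w * q.2) s) =
        mapDomain (Ctx.flat (ofFree Ω q.1) (ofFree Ω q.2)).plug (inclFree k Ω s) := by
      rw [inclFree, mapDomain_mapDomain, mapDomain_mapDomain]
      congr 1
      funext w
      simp [Ctx.plug]
    rw [e]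
    refine TrivialMod.of_lt _ ⟨s, hs, rfl⟩ ?_
    rw [hl hs0]
    simpa [Ctx.plug] using hmono hlt
  have hmul : ∀ f g : MonoidAlgebra k (FreeMonoid Z),
      inclFree k Ω (f * g) = inclFree k Ω f * inclFree k Ω g := fun f g =>
    mapDomain_mul (ofFree Ω) f g
  have hsub : ∀ f g : MonoidAlgebra k (FreeMonoid Z),
      inclFree k Ω (f - g) = inclFree k Ω f - inclFree k Ω g := fun f g => mapDomain_sub' _ f g
  have hof : ∀ w : FreeMonoid Z, inclFree k Ω (of k _ w) = of k _ (ofFree Ω w) := fun w => by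
    simp [inclFree]
  have hbr : ∀ f ∈ inclFree k Ω '' G, f ≠ 0 → BrFree (leadMon f) := by
    rintro _ ⟨γ, hγ, rfl⟩ h
    rw [hl (hne h)]
    exact brFree_ofFree _
  refine ⟨hbr, ?_⟩
  intro f hf g hg hf0 hg0 c d hcd
  -- If `1` is a leading monomial, every word is one in some context and everything is reducible.
  -- Otherwise leading monomials are nonempty, as the analysis of occurrences requires.
  by_cases h1 : ∃ s ∈ inclFree k Ω '' G, s ≠ 0 ∧ leadMon s = 1
  · obtain ⟨s, hs, hs0, hs1⟩ := h1
    refine trivialMod_of_forall_lead hmon.wf hmon.strictMono_plug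
      (fun t => ⟨.flat t 1, s, hs, hs0, by simp [Ctx.plug, hs1]⟩) ?_
    have h3 := (monicize_isMonicLead hg0).mapDomain (hmon.strictMono_plug d)
    rw [← hcd] at h3
    exact ((monicize_isMonicLead hf0).mapDomain (hmon.strictMono_plug c)).sub h3
  push Not at h1
  refine _root_.trivialMod_plug_sub_plug hmon hbr h1 ?_ ?_ hf hg hf0 hg0 c d hcd
  · rintro _ ⟨γ, hγ, rfl⟩ _ ⟨δ, hδ, rfl⟩ hγ0 hδ0 c d e hcd hde hc hd he
    have hγ0' := hne hγ0
    have hδ0' := hne hδ0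
    have hbr1 := hbr _ ⟨γ, hγ, rfl⟩ hγ0
    have hbr2 := hbr _ ⟨δ, hδ, rfl⟩ hδ0
    rw [hcd, brFree_mul, brFree_iff, brFree_iff] at hbr1
    rw [hde, brFree_mul, brFree_iff, brFree_iff] at hbr2
    obtain ⟨⟨c, rfl⟩, d, rfl⟩ := hbr1
    obtain ⟨-, e, rfl⟩ := hbr2
    rw [hl hγ0', ← map_mul] at hcd
    rw [hl hδ0', ← map_mul] at hde
    have hcd := ofFree_injective hcd
    have hde := ofFree_injective hde
    have pos : ∀ {w : FreeMonoid Z}, ofFree Ω w ≠ 1 → 0 < w.length := by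
      intro w hw
      rw [← breadth_ofFree (Ω := Ω)]
      exact Nat.pos_of_ne_zero fun h => hw (breadth_eq_zero.1 h)
    have lc := pos hc
    have ld := pos hd
    have le := pos he
    have := (hG γ hγ δ hδ hγ0' hδ0' _ _ rfl rfl).1 (c * d * e) e c
    rw [leadMon_monicize hγ0', leadMon_monicize hδ0', hcd, hde] at this
    have := hmap (this rfl (mul_assoc _ _ _)
      (by simp only [FreeMonoid.length_mul]; omega) (by simp only [FreeMonoid.length_mul]; omega))
    rw [hsub, hmul, hmul, hof, hof, map_mul, map_mul] at this
    rwa [hmo hγ0', hmo hδ0']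
  · rintro _ ⟨γ, hγ, rfl⟩ _ ⟨δ, hδ, rfl⟩ hγ0 hδ0 a b hab
    have hγ0' := hne hγ0
    have hδ0' := hne hδ0
    have hbr1 := hbr _ ⟨γ, hγ, rfl⟩ hγ0
    rw [hab, brFree_mul, brFree_mul, brFree_iff, brFree_iff, brFree_iff] at hbr1
    obtain ⟨⟨⟨a, rfl⟩, -⟩, b, rfl⟩ := hbr1
    rw [hl hγ0', hl hδ0', ← map_mul, ← map_mul] at hab
    have hab := ofFree_injective hab
    have := (hG γ hγ δ hδ hγ0' hδ0' _ _ rfl rfl).2 (leadMon γ) (a, b)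
    rw [leadMon_monicize hγ0', leadMon_monicize hδ0'] at this
    have := hmap (this rfl hab)
    have e : mapDomain (fun w => (a, b).1 * w * (a, b).2) (monicize δ) =
        of k _ a * monicize δ * of k _ b := by
      rw [← mapDomain_mul_left, ← mapDomain_mul_right, mapDomain_mapDomain]
      rfl
    rw [e, hsub, hmul, hmul, hof, hof] at this
    rwa [hl hγ0', hmo hγ0', hmo hδ0']

variable [LinearOrder (OpWord Ω X)]

/-- The leading monomial of a value of an OPI contains a leading monomial of a set of
elements with bracket-free leading monomials. -/
theorem trivialMod_evalOPI_sub_plug (hmon : IsMonomialOrder Ω Z)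
    {𝒢 𝒯 : Set (MonoidAlgebra k (OpWord Ω Z))} (h𝒯 : 𝒢 ⊆ 𝒯)
    (hbr : ∀ f ∈ 𝒢, f ≠ 0 → BrFree (leadMon f))
    (hpair : ∀ f ∈ 𝒢, ∀ g ∈ 𝒢, f ≠ 0 → g ≠ 0 → ∀ c d : Ctx Ω Z,
      c.plug (leadMon f) = d.plug (leadMon g) →
      TrivialMod Ctx.plug 𝒢 (c.plug (leadMon f))
        (mapDomain c.plug (monicize f) - mapDomain d.plug (monicize g)))
    {φ : MonoidAlgebra k (OpWord Ω X)} (hφ : IsOPI φ) (hφ𝒯 : ∀ σ, evalOPI σ φ ∈ 𝒯)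
    (hna : NoAdjacent (leadMon φ))
    (hlead : ∀ σ : X → OpWord Ω Z,
      evalOPI σ φ = 0 ∨ leadMon (evalOPI σ φ) = (leadMon φ).subst σ)
    {σ : X → OpWord Ω Z} (hf0 : evalOPI σ φ ≠ 0) {g : MonoidAlgebra k (OpWord Ω Z)}
    (hg : g ∈ 𝒢) (hg0 : g ≠ 0) {c : Ctx Ω Z}
    (hc : leadMon (evalOPI σ φ) = c.plug (leadMon g)) :
    TrivialMod Ctx.plug 𝒯 (leadMon (evalOPI σ φ))
      (monicize (evalOPI σ φ) - mapDomain c.plug (monicize g)) := by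
  classical
  set f := evalOPI σ φ with hf
  set w := leadMon g with hw
  set p := leadMon f with hp
  have hF := monicize_isMonicLead hf0
  have hG := (monicize_isMonicLead hg0).mapDomain (hmon.strictMono_plug c)
  rw [← hp] at hF
  rw [← hw, ← hc] at hG
  by_cases hw1 : w = 1
  · exact trivialMod_of_forall_lead hmon.wf hmon.strictMono_plug
      (fun t => ⟨.flat t 1, g, h𝒯 hg, hg0, by simp [Ctx.plug, ← hw, hw1]⟩) (hF.sub hG)
  have hφ0 : φ ≠ 0 := by
    intro h
    rw [hf, h, evalOPI, mapDomain_zero] at hf0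
    exact hf0 rfl
  have hpσ : p = (leadMon φ).subst σ := (hlead σ).resolve_left hf0
  obtain ⟨s, -, hs⟩ := hφ
  obtain ⟨x, hx, d, hd⟩ := hna.exists_plug (hbr g hg hg0) hw1 (hpσ.symm.trans hc)
  have hxs : x ∈ s := by
    by_contra h
    exact hx ((hs _ (leadMon_mem_support hφ0)).2 x h)
  have hctx : ∀ m ∈ φ.coeff.support, ∃ C : Ctx Ω Z, ∀ t,
      m.subst (Function.update σ x t) = C.plug t := by
    intro m hm
    obtain ⟨C, hC⟩ := Ctx.exists_subst_eq_plug ((hs m hm).1 x hxs) σ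
    refine ⟨C, fun t => ?_⟩
    rw [hC _ fun y hy => Function.update_of_ne hy _ _, Function.update_self]
  -- The value of `φ` with `d|_y` inserted for `x`, extended linearly in `y`. It sends `w` to `f`,
  -- smaller words to values of `φ` with smaller leading monomials (or zero), and `g` into the span
  -- of the contexts of `g`.
  let Λ : MonoidAlgebra k (OpWord Ω Z) →ₗ[k] MonoidAlgebra k (OpWord Ω Z) :=
    ∑ m ∈ φ.coeff.support, φ.coeff m •
      mapDomainLinearMap k k fun t => m.subst (Function.update σ x (d.plug t))
  have hΛ : ∀ y, Λ y = ∑ m ∈ φ.coeff.support, φ.coeff m •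
      mapDomain (fun t => m.subst (Function.update σ x (d.plug t))) y := by
    intro y
    simp only [Λ, LinearMap.sum_apply, LinearMap.smul_apply]
    rfl
  have hΛ1 : ∀ t, Λ (single t 1) = evalOPI (Function.update σ x (d.plug t)) φ := by
    intro t
    rw [hΛ, evalOPI]
    conv_rhs => rw [← sum_coeff_single φ, mapDomain_sum]
    refine Finset.sum_congr rfl fun m _ => ?_
    simp only [mapDomain_single, smul_single, smul_eq_mul, mul_one]
  have hΛw : Λ (single w 1) = f := by
    rw [hΛ1, ← hd, Function.update_eq_self]
  have hR : TrivialMod Ctx.plug 𝒯 p (Λ (monicize g - single w 1)) := by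
    refine TrivialMod.of_supported Λ (monicize_isMonicLead hg0) fun t ht => ?_
    rw [hΛ1]
    by_cases h0 : evalOPI (Function.update σ x (d.plug t)) φ = 0
    · rw [h0]
      exact TrivialMod.zero
    have hid : (Ctx.flat 1 1 : Ctx Ω Z).plug = id := by
      funext u
      simp [Ctx.plug]
    have hlt : leadMon (evalOPI (Function.update σ x (d.plug t)) φ) < p := by
      rw [(hlead _).resolve_left h0, hpσ]
      obtain ⟨C, hC⟩ := hctx _ (leadMon_mem_support hφ0)
      have : (leadMon φ).subst σ = C.plug (d.plug w) := by
        rw [← hC, ← hd, Function.update_eq_self]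
      rw [hC, this]
      exact hmon.strictMono_plug C (hmon.strictMono_plug d ht)
    have := TrivialMod.of_lt (plug := Ctx.plug) (p := p) (Ctx.flat 1 1)
      (hφ𝒯 (Function.update σ x (d.plug t))) (by rw [hid]; exact hlt)
    rw [hid] at this
    have e : mapDomain id (evalOPI (Function.update σ x (d.plug t)) φ) =
        evalOPI (Function.update σ x (d.plug t)) φ := by
      apply coeff_injective
      exact Finsupp.mapDomain_id
    rwa [e] at this
  have hspan : Λ (monicize g) - leadCoeff f • mapDomain c.plug (monicize g) ∈
      Submodule.span k {h | ∃ c : Ctx Ω Z, ∃ s ∈ 𝒢, h = mapDomain c.plug s} := by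
    have hgen : ∀ c : Ctx Ω Z, mapDomain c.plug (monicize g) ∈
        Submodule.span k {h | ∃ c : Ctx Ω Z, ∃ s ∈ 𝒢, h = mapDomain c.plug s} := by
      intro c
      rw [monicize, mapDomain_smul']
      exact Submodule.smul_mem _ _ (Submodule.subset_span ⟨c, g, hg, rfl⟩)
    refine Submodule.sub_mem _ ?_ (Submodule.smul_mem _ _ (hgen c))
    rw [hΛ]
    refine Submodule.sum_mem _ fun m hm => Submodule.smul_mem _ _ ?_
    obtain ⟨C, hC⟩ := hctx m hm
    have : (fun t => m.subst (Function.update σ x (d.plug t))) = (C.comp d).plug := by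
      funext t
      rw [hC, Ctx.plug_comp]
    rw [this]
    exact hgen _
  -- The left side lies in the ideal of `𝒢` whether or not `c` is the occurrence given by `d`. The
  -- right side shows that its monomials are `< p`, so the diamond lemma applies.
  have hdecomp : Λ (monicize g) - leadCoeff f • mapDomain c.plug (monicize g) =
      leadCoeff f • (monicize f - mapDomain c.plug (monicize g)) +
        Λ (monicize g - single w 1) := by
    rw [map_sub, hΛw, smul_sub, leadCoeff_smul_monicize hf0]
    abel
  have hsupp : Λ (monicize g) - leadCoeff f • mapDomain c.plug (monicize g) ∈
      supported k k (Set.Iio p) := by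
    rw [hdecomp]
    exact Submodule.add_mem _ (Submodule.smul_mem _ _ (hF.sub hG))
      (hR.mem_supported hmon.strictMono_plug)
  have h1 := (trivialMod_of_mem_span hmon hpair hspan hsupp).mono h𝒯 fun q => ⟨q, rfl⟩
  have h2 := (h1.sub hR).smul (leadCoeff f)⁻¹
  rwa [hdecomp, add_sub_cancel_right, smul_smul, inv_mul_cancel₀ (leadCoeff_ne_zero hf0),
    one_smul] at h2

/-- If the leading monomial of an OPI is a letter, then every word is a leading monomial of a
value of it. -/
theorem exists_leadMon_evalOPI_eq {φ : MonoidAlgebra k (OpWord Ω X)} (hφ : IsOPI φ)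
    (hφ0 : φ ≠ 0)
    (hlead : ∀ σ : X → OpWord Ω Z,
      evalOPI σ φ = 0 ∨ leadMon (evalOPI σ φ) = (leadMon φ).subst σ)
    {x : X} (hx : leadMon φ = var x) (t : OpWord Ω Z) :
    ∃ σ : X → OpWord Ω Z, evalOPI σ φ ≠ 0 ∧ leadMon (evalOPI σ φ) = t := by
  classical
  obtain ⟨s, hsne, hs⟩ := hφ
  have hsx : ∀ y ∈ s, y = x := by
    intro y hy
    have := (hs _ (leadMon_mem_support hφ0)).1 y hy
    rw [hx, occ_var] at this
    by_contra h
    rw [if_neg (Ne.symm h)] at this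
    exact absurd this (by simp)
  have hxs : x ∈ s := by
    obtain ⟨y, hy⟩ := hsne
    exact hsx y hy ▸ hy
  -- The variable `x` is the only one of `φ`, and by size only the monomial `x` can take the value
  -- `t`. So `t` keeps the leading coefficient of `φ`.
  have h0 : evalOPI (Function.update (fun _ => 1) x t) φ ≠ 0 := by
    intro h
    have := coeff_mapDomain_eq (f := OpWord.subst (Function.update (fun _ : X => 1) x t))
      (x := φ) (m₀ := var x) fun m hm hmt => by
        obtain ⟨C, hC⟩ := Ctx.exists_subst_eq_plug ((hs m hm).1 x hxs)
          (fun _ => (1 : OpWord Ω Z))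
        rw [hC _ fun y hy => Function.update_of_ne hy _ _, subst_var,
          Function.update_self] at hmt
        have h1 := eq_one_of_plug_eq_self hmt
        have h2 := hC (fun _ => 1) fun _ _ => rfl
        have h3 : BrFree m := BrFree.of_subst (σ := fun _ => (1 : OpWord Ω Z)) (by
          rw [h2, h1]
          exact brFree_one)
        exact h3.eq_var ((hs m hm).1 x hxs) fun y hy => (hs m hm).2 y fun h => hy (hsx y h)
    rw [evalOPI] at h
    rw [h, ← hx] at this
    exact coeff_leadMon_ne_zero hφ0 this.symm
  exact ⟨_, h0, by rw [(hlead _).resolve_left h0, hx, subst_var, Function.update_self]⟩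

-- Erasing the bracket-free factors `a` and `b` recovers `σ x`, so vanishing of the enlarged value
-- would force vanishing of the original one.
open Classical in
theorem evalOPI_update_ne_zero [Nonempty Ω] [Nonempty Z] (hmon : IsMonomialOrder Ω Z)
    {φ : MonoidAlgebra k (OpWord Ω X)} (hφ : IsOPI φ)
    (hlead : ∀ σ : X → OpWord Ω Z,
      evalOPI σ φ = 0 ∨ leadMon (evalOPI σ φ) = (leadMon φ).subst σ)
    {σ : X → OpWord Ω Z} (hf0 : evalOPI σ φ ≠ 0) (x : X) {a b : OpWord Ω Z} (ha : BrFree a)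
    (hb : BrFree b) :
    evalOPI (Function.update σ x (a * σ x * b)) φ ≠ 0 := by
  intro h
  refine hf0 (evalOPI_eq_zero_of_letterTag hmon hφ hlead (fun y => ?_) h)
  by_cases hy : y = x
  · subst hy
    rw [Function.update_self]
    simpa using ((LetterTag.of_brFree ha).mul (LetterTag.refl (σ y))).mul (LetterTag.of_brFree hb)
  · rw [Function.update_of_ne hy]
    exact LetterTag.refl _

theorem allCompositionsTrivial_starWord_iff {𝒢 : Set (MonoidAlgebra k (OpWord Ω Z))} :
    IsOmegaGSBasis 𝒢 ↔
      AllCompositionsTrivial (C := Ctx Ω Z) Ctx.plug OpWord.breadth 𝒢 := by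
  constructor
  · intro h f₀ hf₀ g₀ hg₀ hf hg f g hf' hg'
    obtain ⟨h1, h2⟩ := h f₀ hf₀ g₀ hg₀ hf hg f g hf' hg'
    refine ⟨fun p u v a b c d => (h1 p u v a b c d).mono subset_rfl Ctx.exists_of_starWord,
      fun p c a b => ?_⟩
    obtain ⟨q, hq⟩ := c.exists_starWord
    rw [hq] at b ⊢
    exact (h2 p q a b).mono subset_rfl Ctx.exists_of_starWord
  · intro h f₀ hf₀ g₀ hg₀ hf hg f g hf' hg'
    obtain ⟨h1, h2⟩ := h f₀ hf₀ g₀ hg₀ hf hg f g hf' hg'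
    refine ⟨fun p u v a b c d => (h1 p u v a b c d).mono subset_rfl Ctx.exists_starWord,
      fun p q a b => ?_⟩
    obtain ⟨c, hc⟩ := Ctx.exists_of_starWord q
    rw [hc] at b ⊢
    exact (h2 p c a b).mono subset_rfl Ctx.exists_starWord

end Compositions

/-! ### Generation of the `Ω`-ideal -/

section OmegaIdeals

open MonoidAlgebra OpWord

variable {k : Type u₁} [Field k] {Ω : Type u₂} {Z : Type u₃}

theorem inclFree_mem_of_mem_span {G : Set (MonoidAlgebra k (FreeMonoid Z))}
    {J : TwoSidedIdeal (MonoidAlgebra k (OpWord Ω Z))} (hJ : ∀ g ∈ G, inclFree k Ω g ∈ J)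
    {f : MonoidAlgebra k (FreeMonoid Z)} (hf : f ∈ TwoSidedIdeal.span G) :
    inclFree k Ω f ∈ J := by
  have : TwoSidedIdeal.span G ≤ J.comap (mapDomainRingHom k (ofFree Ω)) := by
    rw [TwoSidedIdeal.span_le]
    intro g hg
    rw [SetLike.mem_coe, TwoSidedIdeal.mem_comap]
    exact hJ g hg
  exact (TwoSidedIdeal.mem_comap _).1 (this hf)

theorem omegaSpan_union_inclFree (S : Set (MonoidAlgebra k (OpWord Ω Z)))
    (G : Set (MonoidAlgebra k (FreeMonoid Z))) :
    omegaSpan (S ∪ inclFree k Ω '' G) =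
      omegaSpan (S ∪ inclFree k Ω '' (TwoSidedIdeal.span G : Set _)) := by
  unfold omegaSpan
  congr 1
  ext J
  refine and_congr_right fun _ => ⟨fun h => ?_, fun h f hf => h f ?_⟩
  · rintro _ (hf | ⟨f, hf, rfl⟩)
    · exact h _ (Or.inl hf)
    · exact inclFree_mem_of_mem_span (fun g hg => h _ (Or.inr ⟨g, hg, rfl⟩)) hf
  · exact Set.union_subset_union_right S (Set.image_mono TwoSidedIdeal.subset_span) hf

end OmegaIdeals

/-! ### Mixed compositions and the theorem -/

section Mixed

open MonoidAlgebra OpWord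

variable {k : Type u₁} [Field k] {Ω : Type u₂} {X : Type u₃} {Z : Type u₄}
  {Φ : Set (MonoidAlgebra k (OpWord Ω X))} {𝒢 : Set (MonoidAlgebra k (OpWord Ω Z))}

theorem evalOPI_mem_substSet {φ : MonoidAlgebra k (OpWord Ω X)} (hφ : φ ∈ Φ)
    (σ : X → OpWord Ω Z) : evalOPI σ φ ∈ substSet Φ (Set.univ : Set (OpWord Ω Z)) :=
  ⟨φ, hφ, σ, fun _ => Set.mem_univ _, rfl⟩

theorem ne_zero_of_evalOPI_ne_zero {φ : MonoidAlgebra k (OpWord Ω X)} {σ : X → OpWord Ω Z}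
    (h : evalOPI σ φ ≠ 0) : φ ≠ 0 := by
  rintro rfl
  exact h (mapDomain_zero _)

variable [LinearOrder (OpWord Ω X)]

theorem IsOPI.occ_leadMon {φ : MonoidAlgebra k (OpWord Ω X)} (hφ : IsOPI φ) (hφ0 : φ ≠ 0)
    {x : X} (hx : occ x (leadMon φ) ≠ 0) : occ x (leadMon φ) = 1 := by
  obtain ⟨s, -, hs⟩ := hφ
  obtain ⟨h1, h2⟩ := hs _ (leadMon_mem_support hφ0)
  exact h1 x (by_contra fun h => hx (h2 x h))

theorem noAdjacent_leadMon {φ : MonoidAlgebra k (OpWord Ω X)}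
    (hsub : ∀ w : FreeMonoid X, IsSubword (OpWord.ofFree Ω w) (leadMon φ) →
      w = 1 ∨ ∃ x : X, w = FreeMonoid.of x) : NoAdjacent (leadMon φ) := by
  intro c x y h
  obtain ⟨q, hq⟩ := c.exists_starWord
  have hlen : ∀ w : FreeMonoid X, w = 1 ∨ (∃ x : X, w = FreeMonoid.of x) → w.length ≤ 1 := by
    rintro w (rfl | ⟨x, rfl⟩) <;> simp
  have := hlen _ (hsub (FreeMonoid.of x * FreeMonoid.of y) ⟨q, by
    rw [map_mul, ofFree_of, ofFree_of, ← hq, h]⟩)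
  simp at this

variable [LinearOrder (OpWord Ω Z)]

section

variable [Nonempty Ω] (hmon : IsMonomialOrder Ω Z) (hΦ : ∀ φ ∈ Φ, IsOPI φ)
  (hΦGS : AllCompositionsTrivial (C := Ctx Ω Z) Ctx.plug OpWord.breadth
    (substSet Φ (Set.univ : Set (OpWord Ω Z))))
  (hbr : ∀ f ∈ 𝒢, f ≠ 0 → BrFree (leadMon f))
  (hpair : ∀ f ∈ 𝒢, ∀ g ∈ 𝒢, f ≠ 0 → g ≠ 0 → ∀ c d : Ctx Ω Z,
    c.plug (leadMon f) = d.plug (leadMon g) →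
    TrivialMod Ctx.plug 𝒢 (c.plug (leadMon f))
      (mapDomain c.plug (monicize f) - mapDomain d.plug (monicize g)))
  (hna : ∀ φ ∈ Φ, NoAdjacent (leadMon φ))
  (hlead : ∀ φ ∈ Φ, ∀ σ : X → OpWord Ω Z,
    evalOPI σ φ = 0 ∨ leadMon (evalOPI σ φ) = (leadMon φ).subst σ)

include hmon hΦ hΦGS hbr hpair hna hlead

/-- The factor `u` is absorbed into the last variable of `leadMon φ`. The new value has leading
monomial `f̄u = vḡ` and contains both sides, so the intersection is a difference of two inclusions.
-/
theorem trivialMod_intersection_left {φ : MonoidAlgebra k (OpWord Ω X)} (hφ : φ ∈ Φ)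
    {σ : X → OpWord Ω Z} (hf0 : evalOPI σ φ ≠ 0) {g : MonoidAlgebra k (OpWord Ω Z)}
    (hg : g ∈ 𝒢) (hg0 : g ≠ 0) {u v : OpWord Ω Z}
    (h : leadMon (evalOPI σ φ) * u = v * leadMon g)
    (hlt : breadth v < breadth (leadMon (evalOPI σ φ))) :
    TrivialMod Ctx.plug (substSet Φ (Set.univ : Set (OpWord Ω Z)) ∪ 𝒢)
      (leadMon (evalOPI σ φ) * u)
      (monicize (evalOPI σ φ) * of k _ u - of k _ v * monicize g) := by
  classical
  have hφ0 := ne_zero_of_evalOPI_ne_zero hf0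
  have hl := (hlead φ hφ σ).resolve_left hf0
  obtain ⟨e, he, he'⟩ : ∃ e, leadMon (evalOPI σ φ) = v * e ∧ leadMon g = e * u := by
    rcases mul_eq_mul h with h' | ⟨e, he, -⟩
    · exact h'
    · rw [he, breadth_mul] at hlt
      omega
  have hb := hbr g hg hg0
  rw [he', brFree_mul] at hb
  have he1 : e ≠ 1 := by
    rintro rfl
    rw [he, mul_one] at hlt
    exact lt_irrefl _ hlt
  obtain ⟨ψ, x, hψ⟩ := (hna φ hφ).exists_eq_mul_var hb.1 he1 (hl.symm.trans he)
  have hx : occ x (leadMon φ) = 1 :=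
    (hΦ φ hφ).occ_leadMon hφ0 (by rw [hψ]; simp)
  have hxψ : occ x ψ = 0 := by
    rw [hψ, occ_mul, occ_var, if_pos rfl] at hx
    omega
  -- The nonempty overlap supplies the letter of `Z` needed for the nonvanishing argument.
  have := hb.1.nonempty he1
  have hf'0 := evalOPI_update_ne_zero hmon (hΦ φ hφ) (hlead φ hφ) hf0 x brFree_one hb.2
  rw [one_mul] at hf'0
  set σ' := Function.update σ x (σ x * u) with hσ'
  have hl' : leadMon (evalOPI σ' φ) = leadMon (evalOPI σ φ) * u := by
    rw [(hlead φ hφ σ').resolve_left hf'0, hl, hψ, subst_mul, subst_mul, subst_var, subst_var,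
      hσ', Function.update_self, mul_assoc]
    -- The variable `x` occurs only at the end of `leadMon φ`, so the change leaves the part before
    -- it untouched.
    congr 1
    exact subst_congr fun y hy => Function.update_of_ne (by rintro rfl; exact hy hxψ) _ _
  have t1 := (hΦGS _ (evalOPI_mem_substSet hφ σ') _ (evalOPI_mem_substSet hφ σ) hf'0 hf0 _ _
    rfl rfl).2 _ (.flat 1 u) rfl
  rw [leadMon_monicize hf'0, leadMon_monicize hf0, hl', mapDomain_plug_flat, map_one, one_mul] at t1
  have t2 := trivialMod_evalOPI_sub_plug hmon
    (𝒯 := substSet Φ (Set.univ : Set (OpWord Ω Z)) ∪ 𝒢) Set.subset_union_right hbr hpair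
    (hΦ φ hφ) (fun σ => Or.inl (evalOPI_mem_substSet hφ σ)) (hna φ hφ) (hlead φ hφ) hf'0 hg hg0
    (c := .flat v 1) (by rw [hl', h, Ctx.plug, mul_one])
  rw [hl', mapDomain_plug_flat, map_one, mul_one] at t2
  have t1' := (t1 (by rw [Ctx.plug, one_mul])).mono
    (Set.subset_union_left (t := 𝒢)) fun q => ⟨q, rfl⟩
  simpa using t2.sub t1'

/-- Mirror image: `v` is absorbed into the first variable of `leadMon φ`. -/
theorem trivialMod_intersection_right {φ : MonoidAlgebra k (OpWord Ω X)} (hφ : φ ∈ Φ)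
    {σ : X → OpWord Ω Z} (hf0 : evalOPI σ φ ≠ 0) {g : MonoidAlgebra k (OpWord Ω Z)}
    (hg : g ∈ 𝒢) (hg0 : g ≠ 0) {u v : OpWord Ω Z}
    (h : leadMon g * u = v * leadMon (evalOPI σ φ))
    (hlt : breadth v < breadth (leadMon g)) :
    TrivialMod Ctx.plug (substSet Φ (Set.univ : Set (OpWord Ω Z)) ∪ 𝒢)
      (v * leadMon (evalOPI σ φ))
      (monicize g * of k _ u - of k _ v * monicize (evalOPI σ φ)) := by
  classical
  have hφ0 := ne_zero_of_evalOPI_ne_zero hf0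
  have hl := (hlead φ hφ σ).resolve_left hf0
  obtain ⟨e, he, he'⟩ : ∃ e, leadMon g = v * e ∧ leadMon (evalOPI σ φ) = e * u := by
    rcases mul_eq_mul h with h' | ⟨e, he, -⟩
    · exact h'
    · rw [he, breadth_mul] at hlt
      omega
  have hb := hbr g hg hg0
  rw [he, brFree_mul] at hb
  have he1 : e ≠ 1 := by
    rintro rfl
    rw [he, mul_one] at hlt
    exact lt_irrefl _ hlt
  obtain ⟨ψ, x, hψ⟩ := exists_eq_var_mul hb.2 he1 (hl.symm.trans he')
  have hx : occ x (leadMon φ) = 1 :=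
    (hΦ φ hφ).occ_leadMon hφ0 (by rw [hψ]; simp)
  have hxψ : occ x ψ = 0 := by
    rw [hψ, occ_mul, occ_var, if_pos rfl] at hx
    omega
  have := hb.2.nonempty he1
  have hf'0 := evalOPI_update_ne_zero hmon (hΦ φ hφ) (hlead φ hφ) hf0 x hb.1 brFree_one
  rw [mul_one] at hf'0
  set σ' := Function.update σ x (v * σ x) with hσ'
  have hl' : leadMon (evalOPI σ' φ) = v * leadMon (evalOPI σ φ) := by
    rw [(hlead φ hφ σ').resolve_left hf'0, hl, hψ, subst_mul, subst_mul, subst_var, subst_var,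
      hσ', Function.update_self, mul_assoc]
    congr 2
    exact subst_congr fun y hy => Function.update_of_ne (by rintro rfl; exact hy hxψ) _ _
  have t1 := (hΦGS _ (evalOPI_mem_substSet hφ σ') _ (evalOPI_mem_substSet hφ σ) hf'0 hf0 _ _
    rfl rfl).2 _ (.flat v 1) rfl
  rw [leadMon_monicize hf'0, leadMon_monicize hf0, hl', mapDomain_plug_flat, map_one, mul_one] at t1
  have t2 := trivialMod_evalOPI_sub_plug hmon
    (𝒯 := substSet Φ (Set.univ : Set (OpWord Ω Z)) ∪ 𝒢) Set.subset_union_right hbr hpair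
    (hΦ φ hφ) (fun σ => Or.inl (evalOPI_mem_substSet hφ σ)) (hna φ hφ) (hlead φ hφ) hf'0 hg hg0
    (c := .flat 1 u) (by rw [hl', ← h, Ctx.plug, one_mul])
  rw [hl', mapDomain_plug_flat, map_one, one_mul] at t2
  have t1' := (t1 (by rw [Ctx.plug, mul_one])).mono
    (Set.subset_union_left (t := 𝒢)) fun q => ⟨q, rfl⟩
  simpa using t1'.sub t2

end

/-- Here `leadMon φ` is bracket-free, hence a subword of itself without brackets, and so a single
variable; it is not `1` because an OPI has at least one variable. Then every word leads a value of
`φ`. -/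
theorem trivialMod_inclusion_of_brFree (hmon : IsMonomialOrder Ω Z)
    {φ : MonoidAlgebra k (OpWord Ω X)} (hφ : φ ∈ Φ) (hopi : IsOPI φ)
    (hsub : ∀ w : FreeMonoid X, IsSubword (OpWord.ofFree Ω w) (leadMon φ) →
      w = 1 ∨ ∃ x : X, w = FreeMonoid.of x)
    (hlead : ∀ σ : X → OpWord Ω Z,
      evalOPI σ φ = 0 ∨ leadMon (evalOPI σ φ) = (leadMon φ).subst σ)
    {σ : X → OpWord Ω Z} (hf0 : evalOPI σ φ ≠ 0) {g : MonoidAlgebra k (OpWord Ω Z)}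
    (hg0 : g ≠ 0) (hb : BrFree (leadMon g)) {c : Ctx Ω Z}
    (hc : leadMon g = c.plug (leadMon (evalOPI σ φ))) :
    TrivialMod Ctx.plug (substSet Φ (Set.univ : Set (OpWord Ω Z)) ∪ 𝒢) (leadMon g)
      (monicize g - mapDomain c.plug (monicize (evalOPI σ φ))) := by
  have hφ0 := ne_zero_of_evalOPI_ne_zero hf0
  have hl := (hlead σ).resolve_left hf0
  obtain ⟨x, hx⟩ : ∃ x, leadMon φ = var x := by
    have hbφ : BrFree (leadMon φ) := by
      rw [hc, hl] at hb
      cases c with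
      | flat a b =>
        rw [Ctx.plug, brFree_mul, brFree_mul] at hb
        exact hb.1.2.of_subst
      | nest a ω c b =>
        rw [Ctx.plug, brFree_mul, brFree_mul] at hb
        exact absurd hb.1.2 (not_brFree_br _ _)
    obtain ⟨w, hw⟩ := brFree_iff.1 hbφ
    obtain ⟨q, hq⟩ := (Ctx.flat 1 1 : Ctx Ω X).exists_starWord
    rcases hsub w ⟨q, by rw [← hq, hw, Ctx.plug, one_mul, mul_one]⟩ with rfl | ⟨x, rfl⟩
    · obtain ⟨s, ⟨x, hxs⟩, hs⟩ := hopi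
      have := (hs _ (leadMon_mem_support hφ0)).1 x hxs
      rw [← hw, map_one, occ_one] at this
      exact absurd this (by simp)
    · exact ⟨x, by rw [← hw, ofFree_of]⟩
  have hF := (monicize_isMonicLead hf0).mapDomain (hmon.strictMono_plug c)
  rw [← hc] at hF
  refine trivialMod_of_forall_lead hmon.wf hmon.strictMono_plug (fun t => ?_)
    ((monicize_isMonicLead hg0).sub hF)
  obtain ⟨τ, h1, h2⟩ := exists_leadMon_evalOPI_eq hopi hφ0 hlead hx t
  exact ⟨.flat 1 1, _, Or.inl (evalOPI_mem_substSet hφ τ), h1, by simp [Ctx.plug, h2]⟩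

end Mixed

theorem mainTheorem3 {k : Type*} [Field k] {Ω : Type*} [Nonempty Ω] {X Z : Type*}
    -- the order for leading monomials of OPIs, and the monomial order on `𝔐(Z)`
    [LinearOrder (OpWord Ω X)] [LinearOrder (OpWord Ω Z)]
    (hmon : IsMonomialOrder Ω Z)
    (Φ : Set (MonoidAlgebra k (OpWord Ω X))) (hΦ : ∀ φ ∈ Φ, IsOPI φ)
    (IA : TwoSidedIdeal (MonoidAlgebra k (FreeMonoid Z)))
    (hΦGS : IsOmegaGSOn (Z := Z) Φ)
    (G : Set (MonoidAlgebra k (FreeMonoid Z)))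
    (hGspan : TwoSidedIdeal.span G = IA)
    (hGGS : @IsGSBasis k _ Z (restrictOrder Ω Z) G)
    (hsub : ∀ φ ∈ Φ, ∀ w : FreeMonoid X, IsSubword (OpWord.ofFree Ω w) (leadMon φ) →
      w = 1 ∨ ∃ x : X, w = FreeMonoid.of x)
    (hlead : ∀ φ ∈ Φ, ∀ σ : X → OpWord Ω Z,
      evalOPI σ φ = 0 ∨ leadMon (evalOPI σ φ) = (leadMon φ).subst σ) :
    IsOmegaGSBasis (substSet Φ (Set.univ : Set (OpWord Ω Z)) ∪ inclFree k Ω '' G) ∧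
    omegaSpan (substSet Φ (Set.univ : Set (OpWord Ω Z)) ∪ inclFree k Ω '' G) =
      omegaSpan (substSet Φ (Set.univ : Set (OpWord Ω Z)) ∪
        inclFree k Ω '' (IA : Set (MonoidAlgebra k (FreeMonoid Z)))) := by
  refine ⟨?_, by rw [← hGspan]; exact omegaSpan_union_inclFree _ _⟩
  obtain ⟨hbr, hpair⟩ := IsGSBasis.trivialMod_plug_sub_plug hmon hGGS
  have hS := allCompositionsTrivial_starWord_iff.1 hΦGS
  have hna : ∀ φ ∈ Φ, OpWord.NoAdjacent (leadMon φ) := fun φ hφ =>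
    noAdjacent_leadMon (hsub φ hφ)
  rw [allCompositionsTrivial_starWord_iff]
  rintro f₀ hf₀ g₀ hg₀ hf0 hg0 f g rfl rfl
  rw [leadMon_monicize hf0, leadMon_monicize hg0]
  rcases hf₀ with hf₀ | hf₀ <;> rcases hg₀ with hg₀ | hg₀
  · obtain ⟨h1, h2⟩ := hS f₀ hf₀ g₀ hg₀ hf0 hg0 _ _ rfl rfl
    rw [leadMon_monicize hf0, leadMon_monicize hg0] at h1 h2
    exact ⟨fun p u v a b c d => (h1 p u v a b c d).mono Set.subset_union_left fun q => ⟨q, rfl⟩,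
      fun p q a b => (h2 p q a b).mono Set.subset_union_left fun q => ⟨q, rfl⟩⟩
  · obtain ⟨φ, hφ, σ, -, rfl⟩ := hf₀
    refine ⟨fun p u v hu hv _ hlt => ?_, fun p q hp hq => ?_⟩
    -- Since `|p| = |v| + |ḡ|`, the bound on `|p|` says `|v| < |f̄|`, i.e. the two occurrences
    -- really overlap.
    · rw [hv, OpWord.breadth_mul] at hlt
      rw [hu] at hv ⊢
      exact trivialMod_intersection_left hmon hΦ hS hbr hpair hna hlead hφ hf0 hg₀ hg0 hv
        (by omega)
    · rw [hp] at hq ⊢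
      exact trivialMod_evalOPI_sub_plug hmon Set.subset_union_right hbr hpair (hΦ φ hφ)
        (fun σ => Or.inl (evalOPI_mem_substSet hφ σ)) (hna φ hφ) (hlead φ hφ) hf0 hg₀ hg0 hq
  · obtain ⟨φ, hφ, σ, -, rfl⟩ := hg₀
    refine ⟨fun p u v hu hv _ hlt => ?_, fun p q hp hq => ?_⟩
    · rw [hv, OpWord.breadth_mul] at hlt
      rw [hv] at hu ⊢
      exact trivialMod_intersection_right hmon hΦ hS hbr hpair hna hlead hφ hg0 hf₀ hf0 hu.symm
        (by omega)
    · rw [hp] at hq ⊢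
      exact trivialMod_inclusion_of_brFree hmon hφ (hΦ φ hφ) (hsub φ hφ) (hlead φ hφ) hg0 hf0
        (hbr f₀ hf₀ hf0) hq
  · refine ⟨fun p u v hu hv _ _ => ?_, fun p q hp hq => ?_⟩
    · have := hpair f₀ hf₀ g₀ hg₀ hf0 hg0 (.flat 1 u) (.flat v 1) (by
        simpa [Ctx.plug] using hu.symm.trans hv)
      rw [mapDomain_plug_flat, mapDomain_plug_flat, Ctx.plug, map_one, one_mul, one_mul,
        mul_one, ← hu] at this
      exact this.mono Set.subset_union_right fun q => ⟨q, rfl⟩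
    · have := hpair f₀ hf₀ g₀ hg₀ hf0 hg0 (.flat 1 1) q (by
        simpa [Ctx.plug] using hp.symm.trans hq)
      rw [mapDomain_plug_flat, Ctx.plug, map_one, one_mul, one_mul, mul_one, mul_one, ← hp] at this
      exact this.mono Set.subset_union_right fun q => ⟨q, rfl⟩
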